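/- For $k\ge 1$ let $\mathrm{Gr}_k(\mathbb{C}^3)$ be the Grassmannian of $k$-dimensional complex subspaces of $\mathbb{C}^3$, with its usual topology. Let $\mathcal{L}_3$ be the topological poset whose objects are the proper unordered decompositions $\{v_1,\dots,v_m\}$, $m>1$, of $\mathbb{C}^3$ into nonzero, mutually orthogonal subspaces, with the subspace topology from $$\coprod_{m>1}\Bigl[\Bigl(\coprod_{k\ge 1}\mathrm{Gr}_k(\mathbb{C}^3)\Bigr)^{m}/\Sigma_m\Bigr],$$ ordered by coarsening: $\{v_1,\dots,v_m\}\le\{w_1,\dots,w_{m'}\}$ if and only if for each $i$ there is a $j$ with $v_i\subseteq w_j$. The nerve of $\mathcal{L}_3$ is the simplicial space whose space of $k$-simplices is the space of chains $x_0\le\dots\le x_k$, topologized as a subspace of $\mathrm{Obj}(\mathcal{L}_3)^{k+1}$. **Proposition.** The geometric realization of the nerve of $\mathcal{L}_3$ is simply connected (in particular nonempty and path connected). -/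

import Mathlib

/-- The Grassmannian of `k`-dimensional complex subspaces of `ℂⁿ` (with its standard Hermitian
inner product). -/
def Gr (n k : ℕ) : Type :=
  {V : Submodule ℂ (EuclideanSpace ℂ (Fin n)) // Module.finrank ℂ V = k}

/-- The standard topology of the Grassmannian: a subspace is identified with the orthogonal
projection onto it, and the projections carry the operator norm topology. -/
noncomputable instance Gr.instTopologicalSpace (n k : ℕ) : TopologicalSpace (Gr n k) :=
  TopologicalSpace.induced
    (fun V : Gr n k =>
      (V.1.starProjection : EuclideanSpace ℂ (Fin n) →L[ℂ] EuclideanSpace ℂ (Fin n)))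
    inferInstance

/-- The disjoint union, over `k ≥ 1`, of the Grassmannians of `k`-planes in `ℂⁿ`. -/
abbrev NonzeroSubspace (n : ℕ) : Type :=
  Σ k : {k : ℕ // 1 ≤ k}, Gr n k.1

/-- The underlying linear subspace of a point of the disjoint union of Grassmannians. -/
def NonzeroSubspace.toSubmodule {n : ℕ} (V : NonzeroSubspace n) :
    Submodule ℂ (EuclideanSpace ℂ (Fin n)) :=
  V.2.1

/-- Two `m`-tuples are equivalent if they differ by a permutation of the indices. -/
def permSetoid (X : Type) (m : ℕ) : Setoid (Fin m → X) where
  r v w := ∃ σ : Equiv.Perm (Fin m), w = v ∘ σ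
  iseqv :=
    { refl := fun v => ⟨1, rfl⟩
      symm := by
        rintro v w ⟨σ, rfl⟩
        exact ⟨σ⁻¹, by funext i; simp⟩
      trans := by
        rintro u v w ⟨σ, rfl⟩ ⟨τ, rfl⟩
        exact ⟨σ * τ, rfl⟩ }

/-- The orbit space `X ^ m / Σ_m`; it carries the quotient topology of the product topology. -/
abbrev UnorderedTuple (X : Type) (m : ℕ) : Type := Quotient (permSetoid X m)

/-- An ordered tuple of subspaces is an orthogonal decomposition of `ℂⁿ` if its members are
mutually orthogonal and together span `ℂⁿ`. -/
def IsOrthogonalDecomposition {n m : ℕ} (v : Fin m → NonzeroSubspace n) : Prop :=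
  (∀ i j, i ≠ j → (v i).toSubmodule ⟂ (v j).toSubmodule) ∧
    (⨆ i, (v i).toSubmodule) = ⊤

/-- The objects of the topological poset `L_n`: proper unordered decompositions
`{v_1, …, v_m}`, `m > 1`, of `ℂⁿ` into nonzero mutually orthogonal subspaces. -/
def ProperDecomposition (n : ℕ) : Type :=
  {x : Σ m : {m : ℕ // 1 < m}, UnorderedTuple (NonzeroSubspace n) m.1 //
    ∃ v : Fin x.1.1 → NonzeroSubspace n, x.2 = ⟦v⟧ ∧ IsOrthogonalDecomposition v}

namespace ProperDecomposition

/-- The subspace topology from `∐_{m > 1} (∐_{k ≥ 1} Gr_k(ℂⁿ)) ^ m / Σ_m`. -/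
instance instTopologicalSpace (n : ℕ) : TopologicalSpace (ProperDecomposition n) :=
  inferInstanceAs (TopologicalSpace {x : Σ m : {m : ℕ // 1 < m},
    UnorderedTuple (NonzeroSubspace n) m.1 //
      ∃ v : Fin x.1.1 → NonzeroSubspace n, x.2 = ⟦v⟧ ∧ IsOrthogonalDecomposition v})

/-- The set of subspaces that occur in a decomposition. -/
def parts {n : ℕ} (x : ProperDecomposition n) :
    Set (Submodule ℂ (EuclideanSpace ℂ (Fin n))) :=
  Quotient.lift (fun v => Set.range fun i => (v i).toSubmodule)
    (by
      rintro v w ⟨σ, rfl⟩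
      exact (σ.surjective.range_comp fun i => (v i).toSubmodule).symm)
    x.1.2

/-- The order by coarsening: `x ≤ y` if every member of `x` is contained in a member of `y`. -/
instance instPreorder (n : ℕ) : Preorder (ProperDecomposition n) where
  le x y := ∀ V ∈ x.parts, ∃ W ∈ y.parts, V ≤ W
  le_refl _ V hV := ⟨V, hV, le_rfl⟩
  le_trans _ _ _ hxy hyz V hV := by
    obtain ⟨W, hW, hVW⟩ := hxy V hV
    obtain ⟨U, hU, hWU⟩ := hyz W hW
    exact ⟨U, hU, hVW.trans hWU⟩

end ProperDecomposition

/-- The space of `k`-simplices of the nerve of a topological poset `P`: the chains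
`x_0 ≤ … ≤ x_k`, as a subspace of `P ^ (k + 1)`. For `k = 0` this is the space of objects, for
`k = 1` the space of morphisms, and in general the space of `k` composable morphisms. -/
abbrev NerveSimplices (P : Type) [Preorder P] (k : ℕ) : Type :=
  {x : Fin (k + 1) → P // Monotone x}

/-- The simplicial structure map `N_k → N_m` induced by a monotone map `[m] → [k]`. -/
def NerveSimplices.pullback {P : Type} [Preorder P] {m k : ℕ}
    (f : Fin (m + 1) →o Fin (k + 1)) (x : NerveSimplices P k) : NerveSimplices P m :=
  ⟨x.1 ∘ f, x.2.comp f.monotone⟩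

/-- The disjoint union over `k` of `N_k × Δ^k`. -/
abbrev PreRealization (P : Type) [Preorder P] : Type :=
  Σ k : ℕ, NerveSimplices P k × stdSimplex ℝ (Fin (k + 1))

/-- The identifications `(f^* x, t) ∼ (x, f_* t)` for `f : [m] → [k]` monotone, `x ∈ N_k` and
`t ∈ Δ^m`. -/
inductive RealizationRel (P : Type) [Preorder P] : PreRealization P → PreRealization P → Prop
  | glue {m k : ℕ} (f : Fin (m + 1) →o Fin (k + 1)) (x : NerveSimplices P k)
      (t : stdSimplex ℝ (Fin (m + 1))) :
      RealizationRel P ⟨m, (x.pullback f, t)⟩ ⟨k, (x, stdSimplex.map f t)⟩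

/-- The geometric realization of the nerve of a topological poset, with the quotient topology. -/
abbrev NerveRealization (P : Type) [Preorder P] : Type := Quot (RealizationRel P)

/-- The unitary partition complex `L_n`: the realization of the nerve of the topological poset of
proper orthogonal decompositions of `ℂⁿ`. -/
abbrev UnitaryPartitionComplex (n : ℕ) : Type := NerveRealization (ProperDecomposition n)

-- The poset has two levels. A decomposition of `ℂ³` is either an orthogonal frame of three lines
-- (lower level) or a line together with its orthogonal plane (upper level), and comparable elements
-- of the same level coincide. So the realization is a double mapping cylinder: the space of strict
-- inequalities times an interval, with its ends mapped to the two levels. The height of a point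
-- above the lower level is continuous (`continuous_height`). The open sets "height less than 1" and
-- "height greater than 0" deform onto the two levels.
--
-- A van Kampen argument (`SimplyConnectedSpace.of_open_cover`) then needs two facts. First, the
-- space of strict inequalities is path connected: it is the image of the space of ordered frames, a
-- frame being sent to its inclusion under its first line, and ordered frames are joined by
-- rotations about a common line. Second, a path in either level is determined by its endpoints, up
-- to homotopy in the whole realization.
--
-- The upper level is the projective plane of lines in `ℂ³`, which is simply connected. The lower
-- level is the quotient of the space of ordered frames by the symmetric group on three letters, so
-- it is not simply connected. However, a path of frames can be pushed up along the edges to the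
-- path of its `i`th lines. Hence two lifts to ordered frames with the same start whose ends share
-- the `i`th line give homotopic paths (`homotopic_of_lineAt_eq`). This kills every loop whose
-- monodromy fixes an index, in particular the transpositions. A 3-cycle differs from a
-- transposition by a permutation with a fixed index, so nothing survives
-- (`homotopic_of_not_isPair`).

section PathHomotopy

-- Homotopies of paths and a van Kampen criterion

open scoped unitInterval

variable {X Y : Type*} [TopologicalSpace X] [TopologicalSpace Y]

/-- A map of the unit square gives a homotopy between the two composite paths along its sides. -/
theorem Path.Homotopic.of_square {a b c d : X} {p : Path a b} {q : Path c d} {k : Path a c}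
    {l : Path b d} (H : C(I × I, X)) (hp : ∀ t, H (0, t) = p t) (hq : ∀ t, H (1, t) = q t)
    (hk : ∀ s, H (s, 0) = k s) (hl : ∀ s, H (s, 1) = l s) :
    (p.trans l).Homotopic (k.trans q) := by
  let F : p.toContinuousMap.Homotopy q.toContinuousMap :=
    { toContinuousMap := H
      map_zero_left := hp
      map_one_left := hq }
  have h := (Path.Homotopic.map_trans_evalAt F Path.id).pathCast p.source.symm q.target.symm
  convert h using 1
  · ext t
    simp only [Path.trans_apply, Path.cast_coe]
    split_ifs
    · rfl
    · exact (hl _).symm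
  · ext t
    simp only [Path.trans_apply, Path.cast_coe]
    split_ifs
    · exact (hk _).symm
    · rfl

/-- Two paths that are connected by squares with the same sides to homotopic paths are
homotopic. -/
theorem Path.Homotopic.of_trans_homotopic {a b c d : X} {p p' : Path a b} {q q' : Path c d}
    {k : Path a c} {l : Path b d} (h : (p.trans l).Homotopic (k.trans q))
    (h' : (p'.trans l).Homotopic (k.trans q')) (hq : q.Homotopic q') : p.Homotopic p' := by
  rw [← Path.Homotopic.Quotient.eq] at *
  simp only [Path.Homotopic.Quotient.mk_trans] at *
  have e : ∀ r : Path.Homotopic.Quotient a b,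
      (r.trans (.mk l)).trans (Path.Homotopic.Quotient.mk l).symm = r := fun r => by
    rw [Path.Homotopic.Quotient.trans_assoc, Path.Homotopic.Quotient.trans_symm,
      Path.Homotopic.Quotient.trans_refl]
  rw [← e (.mk p), h, hq, ← h', e]

/-- Two paths that lift to paths with the same endpoints in a simply connected space are
homotopic. -/
theorem Path.Homotopic.of_lifts [SimplyConnectedSpace Y] (f : C(Y, X)) {x y : X} (p q : Path x y)
    (p' q' : C(I, Y)) (hp : ∀ t, f (p' t) = p t) (hq : ∀ t, f (q' t) = q t)
    (h0 : p' 0 = q' 0) (h1 : p' 1 = q' 1) : p.Homotopic q := by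
  let P : Path (p' 0) (p' 1) := ⟨p', rfl, rfl⟩
  let Q : Path (p' 0) (p' 1) := ⟨q', h0.symm, h1.symm⟩
  have h := ((SimplyConnectedSpace.paths_homotopic P Q).map f).pathCast
    (p.source.symm.trans (hp 0).symm) (p.target.symm.trans (hp 1).symm)
  convert h using 1
  · ext t; exact (hp t).symm
  · ext t; exact (hq t).symm

/-- A space is simply connected if it has an open cover whose members contain a common point, have
pairwise path connected intersections, and contain only paths that are determined up to homotopy in
the whole space by their endpoints. -/
theorem SimplyConnectedSpace.of_open_cover {ι : Type*} (U : ι → Set X) (hU : ∀ i, IsOpen (U i))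
    (hcov : ∀ x, ∃ i, x ∈ U i) (x₀ : X) (hx₀ : ∀ i, x₀ ∈ U i)
    (hjoin : ∀ i j, ∀ y ∈ U i ∩ U j, JoinedIn (U i ∩ U j) x₀ y)
    (hpath : ∀ i y (p q : Path x₀ y), (∀ t, p t ∈ U i) → (∀ t, q t ∈ U i) → p.Homotopic q) :
    SimplyConnectedSpace X := by
  have hjoined : ∀ y, Joined x₀ y := fun y => by
    obtain ⟨i, hi⟩ := hcov y
    exact (hjoin i i y ⟨hi, hi⟩).joined
  have main : ∀ (y : X) (γ δ : Path x₀ y) (i : ι), (∀ t, δ t ∈ U i) → γ.Homotopic δ := by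
    intro y γ
    obtain ⟨t, ht0, htm, ⟨N, htN⟩, hts⟩ := exists_monotone_Icc_subset_open_cover_unitInterval
      (c := fun i => γ ⁻¹' U i) (fun i => (hU i).preimage γ.continuous)
      (fun s _ => by simpa using hcov (γ s))
    have e0 : γ 0 = x₀ := γ.source
    have hjoin' : ∀ i j, ∀ y ∈ U i ∩ U j, ∃ δ : Path (γ 0) y, ∀ t, δ t ∈ U i ∩ U j := by
      rw [e0]; exact fun i j y hy => ⟨(hjoin i j y hy).somePath, (hjoin i j y hy).somePath_mem⟩
    have hpath' : ∀ i y (p q : Path (γ 0) y), (∀ t, p t ∈ U i) → (∀ t, q t ∈ U i) →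
        p.Homotopic q := by
      rw [e0]; exact hpath
    -- The induction needs the statement for all members of the cover at once: the initial piece of
    -- `γ` may be replaced by any path with the same ends inside any single `U i` that contains one.
    have claim : ∀ n i (δ : Path (γ 0) (γ (t n))), (∀ s, δ s ∈ U i) →
        (γ.subpath 0 (t n)).Homotopic δ := by
      intro n
      induction n with
      | zero =>
        rw [ht0]
        intro i δ hδ
        rw [Path.subpath_self]
        exact hpath' i _ _ _ (fun s => by simpa using hx₀ i) hδ
      | succ n ih =>
        intro i δ hδ
        obtain ⟨j, hj⟩ := hts n
        have hn : t n ≤ t (n + 1) := htm n.le_succ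
        have hj0 : γ (t n) ∈ U j := hj ⟨le_rfl, hn⟩
        have hj1 : γ (t (n + 1)) ∈ U j := hj ⟨hn, le_rfl⟩
        have hi1 : γ (t (n + 1)) ∈ U i := by simpa using hδ 1
        -- The next piece of `γ` lies in `U j`. Replacing the earlier part by `δ'` puts everything
        -- in `U j`; the path `δ''` in `U i ∩ U j` then serves to pass from `U j` to `U i`.
        obtain ⟨δ', hδ'⟩ := hjoin' j j _ ⟨hj0, hj0⟩
        obtain ⟨δ'', hδ''⟩ := hjoin' i j _ ⟨hi1, hj1⟩
        have h1 : (γ.subpath 0 (t (n + 1))).Homotopic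
            (δ'.trans (γ.subpath (t n) (t (n + 1)))) :=
          (show (γ.subpath 0 (t (n + 1))).Homotopic _ from
            ⟨(Path.Homotopy.subpathTransSubpath γ 0 (t n) (t (n + 1))).symm⟩).trans
            ((ih j δ' fun s => (hδ' s).1).hcomp (Path.Homotopic.refl _))
        refine h1.trans ((hpath' j _ _ δ'' ?_ fun s => (hδ'' s).2).trans
          (hpath' i _ _ _ (fun s => (hδ'' s).1) hδ))
        intro s
        have hs : δ'.trans (γ.subpath (t n) (t (n + 1))) s ∈
            Set.range (δ'.trans (γ.subpath (t n) (t (n + 1)))) := ⟨s, rfl⟩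
        rw [Path.trans_range, Path.range_subpath_of_le _ _ _ hn] at hs
        rcases hs with ⟨s', hs'⟩ | ⟨s', hs', hs''⟩
        · rw [← hs']; exact (hδ' s').1
        · rw [← hs'']; exact hj hs'
    intro δ i hδ
    have h := claim N i
    rw [htN N le_rfl] at h
    have h2 := (h (δ.cast e0 γ.target) hδ).pathCast e0.symm γ.target.symm
    convert h2 using 1
    · ext s; simp
    · ext s; rfl
  rw [simply_connected_iff_paths_homotopic']
  have hall : ∀ {y : X} (p q : Path x₀ y), p.Homotopic q := by
    intro y p q
    obtain ⟨i, hi⟩ := hcov y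
    have hJ := hjoin i i y ⟨hi, hi⟩
    have hm : ∀ t, hJ.somePath t ∈ U i := fun t => (hJ.somePath_mem t).1
    exact (main y p _ i hm).trans (main y q _ i hm).symm
  refine ⟨⟨⟨x₀⟩, fun x y => (hjoined x).symm.trans (hjoined y)⟩, fun {x y} p q => ?_⟩
  -- Prefixing a path from `x₀` to `x` reduces to paths that start at `x₀`.
  refine Path.Homotopic.of_trans_homotopic (l := Path.refl y) (k := (hjoined x).somePath.symm)
    (q := (hjoined x).somePath.trans p) (q' := (hjoined x).somePath.trans q) ?_ ?_ (hall _ _) <;>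
  · rw [← Path.Homotopic.Quotient.eq]
    simp only [Path.Homotopic.Quotient.mk_trans, Path.Homotopic.Quotient.mk_symm,
      Path.Homotopic.Quotient.mk_refl, Path.Homotopic.Quotient.trans_refl,
      ← Path.Homotopic.Quotient.trans_assoc, Path.Homotopic.Quotient.symm_trans,
      Path.Homotopic.Quotient.refl_trans]

end PathHomotopy

-- The nerve of a poset with two levels

section HeightOneNerve

open scoped unitInterval

variable {P : Type} [Preorder P]

/-- The chain consisting of the first and the last member of a chain. -/
def NerveSimplices.ends {k : ℕ} (x : NerveSimplices P k) : NerveSimplices P 1 :=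
  ⟨![x.1 0, x.1 (Fin.last k)], by
    rw [Fin.monotone_iff_le_succ]
    intro i
    fin_cases i
    exact x.2 (Fin.zero_le _)⟩

/-- The edge with given endpoints `p ≤ q`. -/
def NerveSimplices.pair {p q : P} (h : p ≤ q) : NerveSimplices P 1 :=
  ⟨![p, q], by
    rw [Fin.monotone_iff_le_succ]
    intro i
    fin_cases i
    exact h⟩

theorem NerveSimplices.continuous_ends [TopologicalSpace P] {k : ℕ} :
    Continuous (NerveSimplices.ends : NerveSimplices P k → NerveSimplices P 1) := by
  refine Continuous.subtype_mk (continuous_pi fun i => ?_) _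
  fin_cases i
  · exact show Continuous fun x : NerveSimplices P k => x.1 0 from
      (continuous_apply 0).comp continuous_subtype_val
  · exact show Continuous fun x : NerveSimplices P k => x.1 (Fin.last k) from
      (continuous_apply (Fin.last k)).comp continuous_subtype_val

namespace NerveRealization

/-- The vertex of the realization that belongs to an element of the poset. -/
def vertex (p : P) : NerveRealization P :=
  Quot.mk _ ⟨0, (⟨fun _ => p, monotone_const⟩, stdSimplex.vertex 0)⟩

/-- The point with coordinates `(1 - t, t)` on an edge of the realization. -/
noncomputable def edge (y : NerveSimplices P 1) (t : I) : NerveRealization P :=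
  Quot.mk _ ⟨1, (y, stdSimplexHomeomorphUnitInterval.symm t)⟩

theorem continuous_vertex [TopologicalSpace P] : Continuous (vertex : P → NerveRealization P) := by
  refine continuous_quot_mk.comp (continuous_sigmaMk.comp (Continuous.prodMk ?_ continuous_const))
  exact Continuous.subtype_mk (continuous_pi fun _ => continuous_id) _

theorem continuous_edge [TopologicalSpace P] :
    Continuous fun z : NerveSimplices P 1 × I => edge z.1 z.2 := by
  refine continuous_quot_mk.comp (continuous_sigmaMk.comp (Continuous.prodMk continuous_fst ?_))
  exact stdSimplexHomeomorphUnitInterval.symm.continuous.comp continuous_snd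

theorem edge_zero (y : NerveSimplices P 1) : edge y 0 = vertex (y.1 0) := by
  have h := Quot.sound (RealizationRel.glue ⟨fun _ : Fin 1 => (0 : Fin 2), monotone_const⟩ y
    (stdSimplex.vertex 0))
  refine Eq.trans ?_ h.symm
  unfold edge
  congr
  rw [stdSimplex.map_vertex, Homeomorph.symm_apply_eq]
  exact stdSimplexHomeomorphUnitInterval_zero.symm

theorem edge_one (y : NerveSimplices P 1) : edge y 1 = vertex (y.1 1) := by
  have h := Quot.sound (RealizationRel.glue ⟨fun _ : Fin 1 => (1 : Fin 2), monotone_const⟩ y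
    (stdSimplex.vertex 0))
  refine Eq.trans ?_ h.symm
  unfold edge
  congr
  rw [stdSimplex.map_vertex, Homeomorph.symm_apply_eq]
  exact stdSimplexHomeomorphUnitInterval_one.symm

theorem mk_eq_vertex {k : ℕ} (x : NerveSimplices P k) (t : stdSimplex ℝ (Fin (k + 1)))
    (p : P) (hx : ∀ i, x.1 i = p) : Quot.mk (RealizationRel P) ⟨k, (x, t)⟩ = vertex p := by
  have h := Quot.sound (RealizationRel.glue (k := 0) ⟨fun _ : Fin (k + 1) => 0, monotone_const⟩
    (⟨fun _ => p, monotone_const⟩ : NerveSimplices P 0) t)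
  have e : x = NerveSimplices.pullback ⟨fun _ : Fin (k + 1) => 0, monotone_const⟩
      (⟨fun _ => p, monotone_const⟩ : NerveSimplices P 0) :=
    Subtype.ext (funext hx)
  rw [e]
  refine h.trans ?_
  unfold vertex
  congr
  apply stdSimplex.ext
  funext i
  have : Unique (Fin (0 + 1)) := inferInstanceAs (Unique (Fin 1))
  rw [stdSimplex.eq_one_of_unique, stdSimplex.eq_one_of_unique]

theorem edge_eq_vertex {y : NerveSimplices P 1} (h : y.1 0 = y.1 1) (t : I) :
    edge y t = vertex (y.1 0) :=
  mk_eq_vertex y _ _ (by intro i; fin_cases i; exacts [rfl, h.symm])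

variable (c : P → Bool)

/-- The total weight of the vertices in the upper level of a poset with two levels. -/
noncomputable def preHeight (z : PreRealization P) : ℝ :=
  ∑ i, z.2.2 i * (if c (z.2.1.1 i) then 1 else 0)

theorem preHeight_glue {m k : ℕ} (f : Fin (m + 1) →o Fin (k + 1)) (x : NerveSimplices P k)
    (t : stdSimplex ℝ (Fin (m + 1))) :
    preHeight c ⟨m, (x.pullback f, t)⟩ = preHeight c ⟨k, (x, stdSimplex.map f t)⟩ := by
  simp only [preHeight, stdSimplex.map_coe, FunOnFinite.linearMap_apply_apply, Finset.sum_mul]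
  rw [← Finset.sum_fiberwise (s := Finset.univ) (g := f)]
  refine Finset.sum_congr rfl fun j _ => Finset.sum_congr rfl fun i hi => ?_
  rw [← (Finset.mem_filter.1 hi).2]
  rfl

/-- The weight of the upper level, as a function on the realization. -/
noncomputable def height : NerveRealization P → ℝ :=
  Quot.lift (preHeight c) (by rintro _ _ ⟨f, x, t⟩; exact preHeight_glue c f x t)

theorem preHeight_mem (z : PreRealization P) : preHeight c z ∈ I := by
  constructor
  · refine Finset.sum_nonneg fun i _ => mul_nonneg (stdSimplex.zero_le _ _) ?_
    split_ifs <;> norm_num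
  · rw [← stdSimplex.sum_eq_one z.2.2]
    refine Finset.sum_le_sum fun i _ => mul_le_of_le_one_right (stdSimplex.zero_le _ _) ?_
    split_ifs <;> norm_num

variable {c}

theorem preHeight_eq_one {z : PreRealization P} (h : ∀ i, c (z.2.1.1 i) = true) :
    preHeight c z = 1 := by
  rw [preHeight, ← stdSimplex.sum_eq_one z.2.2]
  exact Finset.sum_congr rfl fun i _ => by simp [h i]

theorem preHeight_eq_zero {z : PreRealization P} (h : ∀ i, c (z.2.1.1 i) = false) :
    preHeight c z = 0 :=
  Finset.sum_eq_zero fun i _ => by simp [h i]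

theorem continuous_preHeight [TopologicalSpace P] (hc : Continuous c) : Continuous (preHeight (P := P) c) := by
  rw [continuous_sigma_iff]
  intro k
  change Continuous fun z : NerveSimplices P k × stdSimplex ℝ (Fin (k + 1)) =>
    ∑ i, z.2 i * (if c (z.1.1 i) then 1 else 0)
  refine continuous_finsetSum _ fun i _ => Continuous.mul ?_ ?_
  · exact (continuous_apply i).comp (continuous_subtype_val.comp continuous_snd)
  · have h1 : Continuous fun b : Bool => if b then (1 : ℝ) else 0 := continuous_of_discreteTopology
    exact h1.comp (hc.comp ((continuous_apply i).comp (continuous_subtype_val.comp continuous_fst)))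

theorem continuous_height [TopologicalSpace P] (hc : Continuous c) : Continuous (height (P := P) c) :=
  continuous_quot_lift _ (continuous_preHeight hc)

theorem height_edge (y : NerveSimplices P 1) (t : I) (h0 : c (y.1 0) = false)
    (h1 : c (y.1 1) = true) : height c (edge y t) = t := by
  change ∑ i : Fin 2, stdSimplexHomeomorphUnitInterval.symm t i *
    (if c (y.1 i) then 1 else 0) = (t : ℝ)
  rw [Fin.sum_univ_two, h0, h1]
  simp
  rfl

variable (hanti : ∀ p q : P, p ≤ q → c p = c q → p = q) (hmono : Monotone c)

include hanti hmono

/-- A chain in a two-level poset takes only its first and last values, so it is a degeneracy of the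
edge between them. Gluing along this degeneracy adds up the weights on each level, and the upper sum
is the height. -/
theorem mk_eq_edge (z : PreRealization P) :
    Quot.mk (RealizationRel P) z = edge z.2.1.ends ⟨preHeight c z, preHeight_mem c z⟩ := by
  obtain ⟨k, x, t⟩ := z
  have hlo : ∀ i, x.1 0 ≤ x.1 i := fun i => x.2 (Fin.zero_le i)
  have hhi : ∀ i, x.1 i ≤ x.1 (Fin.last k) := fun i => x.2 (Fin.le_last i)
  by_cases heq : c (x.1 0) = c (x.1 (Fin.last k))
  · have hx : ∀ i, x.1 i = x.1 0 := fun i =>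
      (hanti _ _ (hlo i) (le_antisymm (hmono (hlo i)) (heq ▸ hmono (hhi i)))).symm
    rw [mk_eq_vertex x t _ hx, edge_eq_vertex]
    · rfl
    · exact (hx _).symm
  · have h0 : c (x.1 0) = false := by
      cases h : c (x.1 0)
      · rfl
      · exact absurd (le_antisymm (hmono (hlo _)) (by rw [h]; exact Bool.le_true _)) heq
    have h1 : c (x.1 (Fin.last k)) = true := by
      cases h : c (x.1 (Fin.last k))
      · exact absurd (h0.trans h.symm) heq
      · rfl
    let f : Fin (k + 1) →o Fin 2 := ⟨fun i => if c (x.1 i) then 1 else 0, by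
      intro i j hij
      have := hmono (x.2 hij)
      revert this
      dsimp only
      cases c (x.1 i) <;> cases c (x.1 j) <;> decide⟩
    have e : x = x.ends.pullback f := by
      apply Subtype.ext
      funext i
      change x.1 i = x.ends.1 (if c (x.1 i) then 1 else 0)
      cases h : c (x.1 i)
      · exact (hanti _ _ (hlo i) (h0.trans h.symm)).symm
      · exact hanti _ _ (hhi i) (h.trans h1.symm)
    have hs := Quot.sound (RealizationRel.glue f x.ends t)
    rw [← e] at hs
    rw [hs, edge]
    congr
    rw [Homeomorph.eq_symm_apply]
    apply Subtype.ext
    change stdSimplex.map f t 1 = preHeight c ⟨k, x, t⟩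
    simp only [preHeight, stdSimplex.map_coe, FunOnFinite.linearMap_apply_apply, Finset.sum_filter,
      mul_ite, mul_one, mul_zero]
    refine Finset.sum_congr rfl fun i _ => ?_
    change (if (if c (x.1 i) then (1 : Fin 2) else 0) = 1 then _ else _) = _
    cases c (x.1 i) <;> simp

/-- The defining quotient map factors continuously through the edges, by `mk_eq_edge`. Simplices of
dimension above 1 can therefore be ignored, also topologically. -/
theorem isQuotientMap_edge [TopologicalSpace P] (hc : Continuous c) :
    Topology.IsQuotientMap fun z : NerveSimplices P 1 × I => edge z.1 z.2 := by
  have hN : Continuous fun z : PreRealization P =>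
      ((z.2.1.ends, ⟨preHeight c z, preHeight_mem c z⟩) : NerveSimplices P 1 × I) := by
    refine Continuous.prodMk ?_ ((continuous_preHeight hc).subtype_mk _)
    rw [continuous_sigma_iff]
    exact fun k => NerveSimplices.continuous_ends.comp continuous_fst
  refine Topology.IsQuotientMap.of_comp hN continuous_edge ?_
  convert isQuotientMap_quot_mk (r := RealizationRel P) using 1
  funext z
  exact (mk_eq_edge hanti hmono z).symm

/-- The lower end of the edge through a point that is not on the upper level. -/
theorem edge_eq_edge_lower {y y' : NerveSimplices P 1} {t t' : I} (h : edge y t = edge y' t')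
    (hlt : height c (edge y t) < 1) : y.1 0 = y'.1 0 := by
  classical
  -- Below height 1 the first vertex of a chain is on the lower level and survives all gluings; at
  -- height 1 a gluing can change it, so the value there is `none`.
  let F : NerveRealization P → Option P :=
    Quot.lift (fun z => if preHeight c z < 1 then some (z.2.1.1 0) else none) (by
      rintro _ _ ⟨f, x, s⟩
      have hg := preHeight_glue c f x s
      simp only [← hg]
      split_ifs with hs
      · have hle : x.1 0 ≤ x.1 (f 0) := x.2 (Fin.zero_le _)
        have hf : c (x.1 (f 0)) = false := by
          by_contra hne
          rw [Bool.not_eq_false] at hne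
          refine hs.ne (preHeight_eq_one fun i => ?_)
          have := hmono (x.2 (f.monotone (Fin.zero_le i)))
          rw [hne] at this
          exact top_le_iff.1 this
        have h0 : c (x.1 0) = false := by
          have := hmono hle
          rw [hf] at this
          exact le_bot_iff.1 this
        exact congrArg some (hanti _ _ hle (h0.trans hf.symm)).symm
      · rfl)
  have h1 : ∀ (y : NerveSimplices P 1) (t : I), height c (edge y t) < 1 →
      F (edge y t) = some (y.1 0) := fun y t h => if_pos h
  have h2 := h1 y' t' (h ▸ hlt)
  rw [← h, h1 y t hlt] at h2
  exact Option.some_injective _ h2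

/-- Dual to `edge_eq_edge_lower`: at positive height the last vertex is on the upper level and is
unchanged by gluing. -/
theorem edge_eq_edge_upper {y y' : NerveSimplices P 1} {t t' : I} (h : edge y t = edge y' t')
    (hlt : 0 < height c (edge y t)) : y.1 1 = y'.1 1 := by
  classical
  let F : NerveRealization P → Option P :=
    Quot.lift (fun z => if 0 < preHeight c z then some (z.2.1.1 (Fin.last _)) else none) (by
      rintro _ _ ⟨f, x, s⟩
      have hg := preHeight_glue c f x s
      simp only [← hg]
      split_ifs with hs
      · have hle : x.1 (f (Fin.last _)) ≤ x.1 (Fin.last _) := x.2 (Fin.le_last _)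
        have hf : c (x.1 (f (Fin.last _))) = true := by
          by_contra hne
          rw [Bool.not_eq_true] at hne
          refine hs.ne' (preHeight_eq_zero fun i => ?_)
          have := hmono (x.2 (f.monotone (Fin.le_last i)))
          rw [hne] at this
          exact le_bot_iff.1 this
        have h0 : c (x.1 (Fin.last _)) = true := by
          have := hmono hle
          rw [hf] at this
          exact top_le_iff.1 this
        exact congrArg some (hanti _ _ hle (hf.trans h0.symm))
      · rfl)
  have h1 : ∀ (y : NerveSimplices P 1) (t : I), 0 < height c (edge y t) →
      F (edge y t) = some (y.1 1) := fun y t h => if_pos h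
  have h2 := h1 y' t' (h ▸ hlt)
  rw [← h, h1 y t hlt] at h2
  exact Option.some_injective _ h2

end NerveRealization

end HeightOneNerve

-- Deforming the two open halves onto the levels

section TwoLevels

open scoped unitInterval

/-- Suppose that a subset `U` of `X` can be deformed in `X` to the image of `Y`, and that the
images in `X` of paths in `Y` are determined up to homotopy by the endpoints. Then the same holds
for paths in `U`. -/
theorem Path.Homotopic.of_deformation {X Y : Type*} [TopologicalSpace X] [TopologicalSpace Y]
    {f : Y → X} (hf : Continuous f) {U : Set X} (r : C(U, Y)) (K : C(U, C(I, X)))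
    (hK0 : ∀ x, K x 0 = x) (hK1 : ∀ x, K x 1 = f (r x))
    (hY : ∀ (a b : Y) (p q : Path a b), (p.map hf).Homotopic (q.map hf))
    {x y : X} (p q : Path x y) (hp : ∀ t, p t ∈ U) (hq : ∀ t, q t ∈ U) : p.Homotopic q := by
  have hx : x ∈ U := by simpa using hp 0
  have hy : y ∈ U := by simpa using hp 1
  let lift : ∀ p : Path x y, (∀ t, p t ∈ U) → Path (⟨x, hx⟩ : U) ⟨y, hy⟩ := fun p hp =>
    { toFun := fun t => ⟨p t, hp t⟩
      continuous_toFun := p.continuous.subtype_mk hp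
      source' := Subtype.ext p.source
      target' := Subtype.ext p.target }
  let k : ∀ z : U, Path (z : X) (f (r z)) := fun z => ⟨K z, hK0 z, hK1 z⟩
  -- The deformation sweeps out a square between `p` and the image of its retraction; its vertical
  -- sides depend only on the endpoints, so they cancel when `p` and `q` are compared.
  have square : ∀ (p : Path x y) (hp : ∀ t, p t ∈ U),
      (p.trans (k ⟨y, hy⟩)).Homotopic
        ((k ⟨x, hx⟩).trans (((lift p hp).map r.continuous).map hf)) := by
    intro p hp
    have hcont : Continuous fun z : I × I => K (lift p hp z.2) z.1 :=
      (K.continuous.comp ((lift p hp).continuous.comp continuous_snd)).eval continuous_fst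
    refine Path.Homotopic.of_square ⟨_, hcont⟩ (fun t => hK0 _) (fun t => hK1 _) (fun s => ?_)
      (fun s => ?_)
    · exact congrArg (fun z => K z s) (lift p hp).source
    · exact congrArg (fun z => K z s) (lift p hp).target
  exact Path.Homotopic.of_trans_homotopic (square p hp) (square q hq) (hY _ _ _ _)

namespace NerveRealization

variable {P : Type} [Preorder P] {c : P → Bool}
  (hanti : ∀ p q : P, p ≤ q → c p = c q → p = q) (hmono : Monotone c)

include hanti hmono

theorem eq_or_levels (y : NerveSimplices P 1) :
    y.1 0 = y.1 1 ∨ c (y.1 0) = false ∧ c (y.1 1) = true := by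
  have hle : y.1 0 ≤ y.1 1 := y.2 (Fin.zero_le 1)
  have hm := hmono hle
  have ha := hanti _ _ hle
  revert hm ha
  cases c (y.1 0) <;> cases c (y.1 1) <;> simp

theorem edge_mul_eq_vertex {y : NerveSimplices P 1} {t : I} (h : height c (edge y t) = 0) (s : I) :
    edge y (t * s) = vertex (y.1 0) := by
  rcases eq_or_levels hanti hmono y with heq | ⟨h0, h1⟩
  · exact edge_eq_vertex heq _
  · rw [height_edge y t h0 h1] at h
    rw [show t = 0 from Subtype.ext h, zero_mul, edge_zero]

theorem edge_symm_mul_eq_vertex {y : NerveSimplices P 1} {t : I}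
    (h : height c (edge y t) = 1) (s : I) :
    edge y (σ (σ t * s)) = vertex (y.1 1) := by
  rcases eq_or_levels hanti hmono y with heq | ⟨h0, h1⟩
  · rw [edge_eq_vertex heq, heq]
  · rw [height_edge y t h0 h1] at h
    rw [show t = 1 from Subtype.ext h, unitInterval.symm_one, zero_mul, unitInterval.symm_zero,
      edge_one]

theorem edge_congr {y y' : NerveSimplices P 1} {t t' : I} (h : edge y t = edge y' t')
    (hpos : 0 < height c (edge y t)) (hlt : height c (edge y t) < 1) (f : I → I) :
    edge y (f t) = edge y' (f t') := by
  have e0 := edge_eq_edge_lower hanti hmono h hlt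
  have e1 := edge_eq_edge_upper hanti hmono h hpos
  have e : y = y' := by
    apply Subtype.ext
    funext i
    fin_cases i
    exacts [e0, e1]
  subst e
  rcases eq_or_levels hanti hmono y with heq | ⟨h0, h1⟩
  · rw [edge_eq_vertex heq, edge_eq_vertex heq]
  · have ht := congrArg (height c) h
    rw [height_edge y t h0 h1, height_edge y t' h0 h1] at ht
    rw [Subtype.ext ht]

/-- Sliding down an edge is well defined below the upper level: at height 0 the point stays at its
vertex, and at heights strictly between 0 and 1 both ends of the edge are determined. -/
theorem edge_mul_congr {y y' : NerveSimplices P 1} {t t' : I} (h : edge y t = edge y' t')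
    (hlt : height c (edge y t) < 1) (s : I) : edge y (t * s) = edge y' (t' * s) := by
  by_cases h0 : height c (edge y t) = 0
  · rw [edge_mul_eq_vertex hanti hmono h0, edge_mul_eq_vertex hanti hmono (h ▸ h0),
      edge_eq_edge_lower hanti hmono h hlt]
  · have hge : 0 ≤ height c (edge y t) := (preHeight_mem c _).1
    exact edge_congr hanti hmono h (hge.lt_of_ne (Ne.symm h0)) hlt fun t => t * s

theorem edge_symm_mul_congr {y y' : NerveSimplices P 1} {t t' : I} (h : edge y t = edge y' t')
    (hpos : 0 < height c (edge y t)) (s : I) :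
    edge y (σ (σ t * s)) = edge y' (σ (σ t' * s)) := by
  by_cases h0 : height c (edge y t) = 1
  · rw [edge_symm_mul_eq_vertex hanti hmono h0, edge_symm_mul_eq_vertex hanti hmono (h ▸ h0),
      edge_eq_edge_upper hanti hmono h hpos]
  · have hle : height c (edge y t) ≤ 1 := (preHeight_mem c _).2
    exact edge_congr hanti hmono h hpos (hle.lt_of_ne h0) fun t => σ (σ t * s)

variable [TopologicalSpace P] (hc : Continuous c)
  (hP : ∀ (a b : P) (p q : Path a b),
    (p.map (continuous_vertex (P := P))).Homotopic (q.map continuous_vertex))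

include hc hP

theorem homotopic_of_height_lt_one {x y : NerveRealization P} (p q : Path x y)
    (hp : ∀ t, height c (p t) < 1) (hq : ∀ t, height c (q t) < 1) : p.Homotopic q := by
  let U : Set (NerveRealization P) := {x | height c x < 1}
  have hU : IsOpen U := isOpen_lt (continuous_height hc) continuous_const
  -- A quotient map stays one over an open set, so the retraction and the deformation may be defined
  -- on edges and descended.
  have hQ' := (isQuotientMap_edge hanti hmono hc).restrictPreimage_isOpen hU
  let Q : C((fun z : NerveSimplices P 1 × I => edge z.1 z.2) ⁻¹' U, U) := ⟨_, hQ'.continuous⟩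
  have hQ : Topology.IsQuotientMap Q := hQ'
  let g : C((fun z : NerveSimplices P 1 × I => edge z.1 z.2) ⁻¹' U, P) :=
    ⟨fun z => z.1.1.1 0, (continuous_apply 0).comp
      (continuous_subtype_val.comp (continuous_fst.comp continuous_subtype_val))⟩
  have hg : Function.FactorsThrough g Q := fun z z' h =>
    edge_eq_edge_lower hanti hmono (congrArg Subtype.val h) z.2
  -- The deformation is curried so that it descends along `Q` itself, rather than along the product
  -- of `Q` with an interval. The parameter `t * σ s` runs from `t` to `0`.
  let k : C((fun z : NerveSimplices P 1 × I => edge z.1 z.2) ⁻¹' U, C(I, NerveRealization P)) :=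
    ContinuousMap.curry ⟨fun w => edge w.1.1.1 (w.1.1.2 * σ w.2),
      continuous_edge.comp ((continuous_fst.comp (continuous_subtype_val.comp continuous_fst)).prodMk
        (show Continuous fun w : ((fun z : NerveSimplices P 1 × I => edge z.1 z.2) ⁻¹' U) × I =>
          w.1.1.2 * σ w.2 by fun_prop))⟩
  have hk : Function.FactorsThrough k Q := fun z z' h =>
    ContinuousMap.ext fun s =>
      edge_mul_congr hanti hmono (congrArg Subtype.val h) z.2 (σ s)
  have hr : ∀ z, hQ.lift g hg (Q z) = g z := fun z =>
    DFunLike.congr_fun (hQ.lift_comp g hg) z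
  have hK : ∀ z, hQ.lift k hk (Q z) = k z := fun z =>
    DFunLike.congr_fun (hQ.lift_comp k hk) z
  refine Path.Homotopic.of_deformation continuous_vertex (hQ.lift g hg) (hQ.lift k hk) ?_ ?_ hP
    p q hp hq
  · intro x
    obtain ⟨z, rfl⟩ := hQ.surjective x
    rw [hK]
    change edge z.1.1 (z.1.2 * σ 0) = edge z.1.1 z.1.2
    rw [unitInterval.symm_zero, mul_one]
  · intro x
    obtain ⟨z, rfl⟩ := hQ.surjective x
    rw [hK, hr]
    change edge z.1.1 (z.1.2 * σ 1) = vertex (z.1.1.1 0)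
    rw [unitInterval.symm_one, mul_zero, edge_zero]

theorem homotopic_of_height_pos {x y : NerveRealization P} (p q : Path x y)
    (hp : ∀ t, 0 < height c (p t)) (hq : ∀ t, 0 < height c (q t)) : p.Homotopic q := by
  let U : Set (NerveRealization P) := {x | 0 < height c x}
  have hU : IsOpen U := isOpen_lt continuous_const (continuous_height hc)
  have hQ' := (isQuotientMap_edge hanti hmono hc).restrictPreimage_isOpen hU
  let Q : C((fun z : NerveSimplices P 1 × I => edge z.1 z.2) ⁻¹' U, U) := ⟨_, hQ'.continuous⟩
  have hQ : Topology.IsQuotientMap Q := hQ'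
  let g : C((fun z : NerveSimplices P 1 × I => edge z.1 z.2) ⁻¹' U, P) :=
    ⟨fun z => z.1.1.1 1, (continuous_apply 1).comp
      (continuous_subtype_val.comp (continuous_fst.comp continuous_subtype_val))⟩
  have hg : Function.FactorsThrough g Q := fun z z' h =>
    edge_eq_edge_upper hanti hmono (congrArg Subtype.val h) z.2
  -- Here the parameter `σ (σ t * σ s)` runs from `t` to `1`.
  let k : C((fun z : NerveSimplices P 1 × I => edge z.1 z.2) ⁻¹' U, C(I, NerveRealization P)) :=
    ContinuousMap.curry ⟨fun w => edge w.1.1.1 (σ (σ w.1.1.2 * σ w.2)),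
      continuous_edge.comp ((continuous_fst.comp (continuous_subtype_val.comp continuous_fst)).prodMk
        (show Continuous fun w : ((fun z : NerveSimplices P 1 × I => edge z.1 z.2) ⁻¹' U) × I =>
          σ (σ w.1.1.2 * σ w.2) by fun_prop))⟩
  have hk : Function.FactorsThrough k Q := fun z z' h =>
    ContinuousMap.ext fun s =>
      edge_symm_mul_congr hanti hmono (congrArg Subtype.val h) z.2 (σ s)
  have hr : ∀ z, hQ.lift g hg (Q z) = g z := fun z =>
    DFunLike.congr_fun (hQ.lift_comp g hg) z
  have hK : ∀ z, hQ.lift k hk (Q z) = k z := fun z =>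
    DFunLike.congr_fun (hQ.lift_comp k hk) z
  refine Path.Homotopic.of_deformation continuous_vertex (hQ.lift g hg) (hQ.lift k hk) ?_ ?_ hP
    p q hp hq
  · intro x
    obtain ⟨z, rfl⟩ := hQ.surjective x
    rw [hK]
    change edge z.1.1 (σ (σ z.1.2 * σ 0)) = edge z.1.1 z.1.2
    rw [unitInterval.symm_zero, mul_one, unitInterval.symm_symm]
  · intro x
    obtain ⟨z, rfl⟩ := hQ.surjective x
    rw [hK, hr]
    change edge z.1.1 (σ (σ z.1.2 * σ 1)) = vertex (z.1.1.1 1)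
    rw [unitInterval.symm_one, mul_zero, unitInterval.symm_zero, edge_one]

/-- The realization of the nerve of a topological poset with two levels is simply connected if the
space of morphisms between the levels is path connected, every object is the source or the target
of such a morphism, and paths of objects are determined in the realization up to homotopy by their
endpoints. -/
theorem simplyConnectedSpace
    (hE : IsPathConnected {y : NerveSimplices P 1 | c (y.1 0) = false ∧ c (y.1 1) = true})
    (hlo : ∀ a, c a = false → ∃ b, a ≤ b ∧ c b = true)
    (hhi : ∀ b, c b = true → ∃ a, a ≤ b ∧ c a = false) :
    SimplyConnectedSpace (NerveRealization P) := by
  -- By `hlo` and `hhi` even a vertex lies on an edge that joins the two levels, and on such an edge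
  -- the height is the parameter.
  have hrep : ∀ x : NerveRealization P, ∃ (y : NerveSimplices P 1) (t : I),
      (c (y.1 0) = false ∧ c (y.1 1) = true) ∧ edge y t = x := by
    intro x
    obtain ⟨⟨y, t⟩, rfl⟩ := (isQuotientMap_edge hanti hmono hc).surjective x
    rcases eq_or_levels hanti hmono y with heq | h
    · dsimp only
      rw [edge_eq_vertex heq]
      cases h : c (y.1 0)
      · obtain ⟨b, hab, hb⟩ := hlo _ h
        exact ⟨NerveSimplices.pair hab, 0, ⟨h, hb⟩, edge_zero _⟩
      · obtain ⟨a, hab, ha⟩ := hhi _ h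
        exact ⟨NerveSimplices.pair hab, 1, ⟨ha, h⟩, edge_one _⟩
    · exact ⟨y, t, h, rfl⟩
  obtain ⟨y₀, hy₀, hy₀'⟩ := hE
  let m : I := ⟨1 / 2, by norm_num, by norm_num⟩
  let U : Bool → Set (NerveRealization P) := fun i =>
    {x | cond i (0 < height c x) (height c x < 1)}
  have hm : ∀ {y : NerveSimplices P 1}, c (y.1 0) = false ∧ c (y.1 1) = true → ∀ i,
      edge y m ∈ U i := by
    intro y hy i
    have := height_edge y m hy.1 hy.2
    cases i
    · change height c (edge y m) < 1; rw [this]; norm_num [m]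
    · change 0 < height c (edge y m); rw [this]; norm_num [m]
  have hconv : ∀ {y : NerveSimplices P 1}, c (y.1 0) = false ∧ c (y.1 1) = true → ∀ i t,
      edge y t ∈ U i → ∀ s ∈ Set.uIcc m t, edge y s ∈ U i := by
    intro y hy i t ht s hs
    have h1 : (s : ℝ) ∈ Set.uIcc (m : ℝ) t := by
      rw [Set.mem_uIcc] at hs ⊢; exact hs
    have hm0 := hm hy i
    cases i
    · change height c (edge y _) < 1 at ht hm0 ⊢
      rw [height_edge y _ hy.1 hy.2] at ht hm0 ⊢
      exact h1.2.trans_lt (max_lt hm0 ht)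
    · change 0 < height c (edge y _) at ht hm0 ⊢
      rw [height_edge y _ hy.1 hy.2] at ht hm0 ⊢
      exact (lt_min hm0 ht).trans_le h1.1
  refine SimplyConnectedSpace.of_open_cover U ?_ ?_ (edge y₀ m) (hm hy₀) ?_ ?_
  · rintro (_ | _)
    · exact isOpen_lt (continuous_height hc) continuous_const
    · exact isOpen_lt continuous_const (continuous_height hc)
  · intro x
    rcases lt_or_ge (height c x) 1 with h | h
    · exact ⟨false, h⟩
    · exact ⟨true, zero_lt_one.trans_le h⟩
  · intro i j x hx
    obtain ⟨y, t, hy, rfl⟩ := hrep x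
    -- Travel at height 1/2 through the space of strict inequalities, then along a single edge.
    have J1 : JoinedIn (U i ∩ U j) (edge y₀ m) (edge y m) := by
      obtain ⟨γ, hγ⟩ := hy₀' hy
      have hcont : Continuous fun z : NerveSimplices P 1 => edge z m :=
        continuous_edge.comp (Continuous.prodMk continuous_id continuous_const)
      exact ⟨γ.map hcont, fun s => ⟨hm (hγ s) i, hm (hγ s) j⟩⟩
    have J2 : JoinedIn (U i ∩ U j) (edge y m) (edge y t) := by
      have hcont : Continuous fun s : I => edge y s :=
        continuous_edge.comp (Continuous.prodMk continuous_const continuous_id)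
      refine ⟨(Path.id.subpath m t).map hcont, fun s => ?_⟩
      have hs : Path.id.subpath m t s ∈ Set.uIcc m t := by
        have : Path.id.subpath m t s ∈ Set.range (Path.id.subpath m t) := ⟨s, rfl⟩
        rw [Path.range_subpath] at this
        obtain ⟨u, hu, hu'⟩ := this
        rw [← hu']
        exact hu
      exact ⟨hconv hy i t hx.1 _ hs, hconv hy j t hx.2 _ hs⟩
    exact J1.trans J2
  · rintro (_ | _) y p q hp hq
    · exact homotopic_of_height_lt_one hanti hmono hc hP p q hp hq
    · exact homotopic_of_height_pos hanti hmono hc hP p q hp hq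

end NerveRealization

end TwoLevels

-- Complex projective space is simply connected

namespace Gr

open scoped ComplexConjugate

variable {n k : ℕ}

theorem continuous_starProjection :
    Continuous fun V : Gr n k =>
      (V.1.starProjection : EuclideanSpace ℂ (Fin n) →L[ℂ] EuclideanSpace ℂ (Fin n)) :=
  continuous_induced_dom

theorem continuous_of_starProjection {X : Type*} [TopologicalSpace X] {f : X → Gr n k}
    (hf : Continuous fun x => (f x).1.starProjection) : Continuous f :=
  continuous_induced_rng.2 hf

/-- The line through a nonzero vector. -/
def line (v : {v : EuclideanSpace ℂ (Fin n) // v ≠ 0}) : Gr n 1 :=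
  ⟨ℂ ∙ v.1, finrank_span_singleton v.2⟩

theorem continuous_line : Continuous (line (n := n)) := by
  refine continuous_of_starProjection ?_
  have h : ∀ v : {v : EuclideanSpace ℂ (Fin n) // v ≠ 0}, (line v).1.starProjection =
      ((‖v.1‖ ^ 2 : ℝ) : ℂ)⁻¹ • ContinuousLinearMap.smulRightL ℂ (EuclideanSpace ℂ (Fin n))
        (EuclideanSpace ℂ (Fin n)) (innerSL ℂ v.1) v.1 := by
    intro v
    ext1 w
    change (ℂ ∙ v.1).starProjection w = _
    rw [Submodule.starProjection_singleton]
    simp [div_eq_inv_mul, mul_smul]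
  simp only [h]
  have h0 : ∀ v : {v : EuclideanSpace ℂ (Fin n) // v ≠ 0}, ((‖v.1‖ ^ 2 : ℝ) : ℂ) ≠ 0 := by
    intro v
    simpa using v.2
  refine Continuous.smul (Continuous.inv₀ (by fun_prop) h0) ?_
  exact ((ContinuousLinearMap.smulRightL ℂ _ _).continuous.comp
    ((innerSL ℂ).continuous.comp continuous_subtype_val)).clm_apply continuous_subtype_val

theorem eq_line_of_mem {L : Gr n 1} {v : EuclideanSpace ℂ (Fin n)} (hv : v ∈ L.1) (h0 : v ≠ 0) :
    L = line ⟨v, h0⟩ := by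
  refine Subtype.ext (Submodule.eq_of_le_of_finrank_eq ?_ ?_).symm
  · rw [line, Submodule.span_singleton_le_iff_mem]
    exact hv
  · rw [L.2]
    exact (line ⟨v, h0⟩).2

theorem exists_eq_line (L : Gr n 1) : ∃ v, L = line v := by
  obtain ⟨v, hv, h0⟩ := Submodule.exists_mem_ne_zero_of_ne_bot (p := L.1) (by
    intro h
    have := L.2
    rw [h, finrank_bot] at this
    exact zero_ne_one this)
  exact ⟨⟨v, h0⟩, eq_line_of_mem hv h0⟩

/-- The lines that do not lie in the `i`th coordinate hyperplane. -/
def chart (i : Fin n) : Set (Gr n 1) :=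
  {L | L.1.starProjection (EuclideanSpace.single i 1) i ≠ 0}

theorem line_mem_chart {i : Fin n} {v : {v : EuclideanSpace ℂ (Fin n) // v ≠ 0}} :
    line v ∈ chart i ↔ v.1 i ≠ 0 := by
  change (ℂ ∙ v.1).starProjection _ i ≠ 0 ↔ _
  rw [Submodule.starProjection_singleton]
  simp [v.2, EuclideanSpace.inner_single_right]

theorem continuous_starProjection_apply (w : EuclideanSpace ℂ (Fin n)) :
    Continuous fun V : Gr n k => V.1.starProjection w :=
  continuous_starProjection.clm_apply continuous_const

theorem isOpen_chart (i : Fin n) : IsOpen (chart i) :=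
  isOpen_ne_fun ((EuclideanSpace.proj (𝕜 := ℂ) i).continuous.comp (continuous_starProjection_apply _))
    continuous_const

theorem ne_zero_of_apply_ne {v : EuclideanSpace ℂ (Fin n)} {i : Fin n} (h : v i ≠ 0) : v ≠ 0 := by
  rintro rfl
  exact h rfl

/-- On the complex affine line through `v` and `w` the `i`th coordinate is constant, and the `j`th
vanishes for at most one parameter. The complex plane minus a point is path connected. -/
theorem joinedIn_chart (i j : Fin n) {v w : EuclideanSpace ℂ (Fin n)} (hvi : v i ≠ 0)
    (hwi : w i = v i) (hvj : v j ≠ 0) (hwj : w j ≠ 0) :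
    JoinedIn (chart i ∩ chart j) (line ⟨v, ne_zero_of_apply_ne hvj⟩)
      (line ⟨w, ne_zero_of_apply_ne hwj⟩) := by
  let S : Set ℂ := {z | v j + z * (w j - v j) = 0}
  have hS : S.Countable := by
    refine Set.Subsingleton.countable fun z hz z' hz' => ?_
    have hd : w j - v j ≠ 0 := by
      intro h
      have hz : v j + z * (w j - v j) = 0 := hz
      rw [h, mul_zero, add_zero] at hz
      exact hvj hz
    have hzz : z * (w j - v j) = z' * (w j - v j) := by
      have h1 : v j + z * (w j - v j) = 0 := hz
      have h2 : v j + z' * (w j - v j) = 0 := hz'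
      linear_combination h1 - h2
    exact mul_right_cancel₀ hd hzz
  have hpc := hS.isPathConnected_compl_of_one_lt_rank
    (by rw [Complex.rank_real_complex]; exact Nat.one_lt_ofNat)
  obtain ⟨γ, hγ⟩ := hpc.joinedIn 0 (by simpa [S] using hvj) 1 (by simpa [S] using hwj)
  have hi : ∀ t, (v + γ t • (w - v)) i ≠ 0 := fun t => by simpa [hwi] using hvi
  have hj : ∀ t, (v + γ t • (w - v)) j ≠ 0 := fun t => by simpa [S] using hγ t
  refine ⟨⟨⟨fun t => line ⟨v + γ t • (w - v), ne_zero_of_apply_ne (hi t)⟩, ?_⟩, ?_, ?_⟩, ?_⟩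
  · exact continuous_line.comp (Continuous.subtype_mk (by fun_prop) _)
  · simp
  · simp
  · exact fun t => ⟨line_mem_chart.2 (hi t), line_mem_chart.2 (hj t)⟩

/-- Each line in the chart meets the convex set `v i = 1` in one point, which depends continuously
on the line: it is the projection of the `i`th basis vector, rescaled. So paths in the chart lift to
a contractible space. -/
theorem homotopic_of_mem_chart (i : Fin n) {x y : Gr n 1} (p q : Path x y)
    (hp : ∀ t, p t ∈ chart i) (hq : ∀ t, q t ∈ chart i) : p.Homotopic q := by
  let S : Set (EuclideanSpace ℂ (Fin n)) := {v | v i = 1}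
  have hconv : Convex ℝ S := by
    intro v hv w hw a b _ _ hab
    have hv : v i = 1 := hv
    have hw : w i = 1 := hw
    change (a • v + b • w) i = 1
    simp [hv, hw, ← Complex.ofReal_add, hab]
  have : ContractibleSpace S :=
    hconv.contractibleSpace ⟨EuclideanSpace.single i 1, by simp [S]⟩
  have hS : ∀ v : S, v.1 ≠ 0 := fun v => ne_zero_of_apply_ne (i := i) (by
    rw [show v.1 i = 1 from v.2]; exact one_ne_zero)
  let f : C(S, Gr n 1) :=
    ⟨fun v => line ⟨v.1, hS v⟩, continuous_line.comp (continuous_subtype_val.subtype_mk _)⟩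
  let r : Gr n 1 → EuclideanSpace ℂ (Fin n) := fun L =>
    (L.1.starProjection (EuclideanSpace.single i 1) i)⁻¹ •
      L.1.starProjection (EuclideanSpace.single i 1)
  have hr : ∀ L ∈ chart i, r L ∈ S := fun L hL => by
    change ((L.1.starProjection _ i)⁻¹ • L.1.starProjection _) i = 1
    rw [PiLp.smul_apply, smul_eq_mul]
    exact inv_mul_cancel₀ hL
  have hrc : ∀ (p : Path x y), (∀ t, p t ∈ chart i) → Continuous fun t => r (p t) := by
    intro p hp
    have h1 : Continuous fun t => (p t).1.starProjection (EuclideanSpace.single i 1) :=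
      (continuous_starProjection_apply _).comp p.continuous
    refine Continuous.smul (Continuous.inv₀ ?_ hp) h1
    exact (EuclideanSpace.proj (𝕜 := ℂ) i).continuous.comp h1
  have hf : ∀ L (hL : L ∈ chart i), f ⟨r L, hr L hL⟩ = L := fun L hL =>
    (eq_line_of_mem (Submodule.smul_mem _ _ (Submodule.starProjection_apply_mem _ _)) _).symm
  refine Path.Homotopic.of_lifts f p q ⟨fun t => ⟨r (p t), hr _ (hp t)⟩, (hrc p hp).subtype_mk _⟩
    ⟨fun t => ⟨r (q t), hr _ (hq t)⟩, (hrc q hq).subtype_mk _⟩ (fun t => hf _ (hp t)) (fun t => hf _ (hq t))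
    ?_ ?_
  · simp
  · simp

/-- Complex projective space is simply connected. -/
instance [NeZero n] : SimplyConnectedSpace (Gr n 1) := by
  -- The all-ones vector spans a line that lies in every chart.
  let e : EuclideanSpace ℂ (Fin n) := WithLp.toLp 2 fun _ => 1
  have he : ∀ i, e i ≠ 0 := fun _ => one_ne_zero
  refine SimplyConnectedSpace.of_open_cover chart isOpen_chart ?_
    (line ⟨e, ne_zero_of_apply_ne (he 0)⟩) (fun i => line_mem_chart.2 (he i)) ?_
    fun i y p q => homotopic_of_mem_chart i p q
  · intro L
    obtain ⟨v, rfl⟩ := exists_eq_line L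
    by_contra! h
    refine v.2 (PiLp.ext fun i => ?_)
    by_contra hi
    exact h i (line_mem_chart.2 hi)
  · rintro i j L ⟨hi, hj⟩
    obtain ⟨v, rfl⟩ := exists_eq_line L
    rw [line_mem_chart] at hi hj
    have hw : ((v.1 i)⁻¹ • v.1) j ≠ 0 := mul_ne_zero (inv_ne_zero hi) hj
    rw [eq_line_of_mem (L := line v) (v := (v.1 i)⁻¹ • v.1)
      (Submodule.smul_mem _ _ (Submodule.mem_span_singleton_self _)) (ne_zero_of_apply_ne hw)]
    exact joinedIn_chart i j (he i) (inv_mul_cancel₀ hi) (he j) hw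

end Gr

-- Orthogonal decompositions, ordered and unordered

namespace NonzeroSubspace

variable {n : ℕ}

theorem finrank_toSubmodule (V : NonzeroSubspace n) :
    Module.finrank ℂ V.toSubmodule = V.1.1 := V.2.2

theorem toSubmodule_ne_bot (V : NonzeroSubspace n) : V.toSubmodule ≠ ⊥ := by
  intro h
  have h1 := V.1.2
  rw [← finrank_toSubmodule, h, finrank_bot] at h1
  exact absurd h1 (by norm_num)

theorem toSubmodule_injective :
    Function.Injective (toSubmodule : NonzeroSubspace n → _) := by
  rintro ⟨⟨k, hk⟩, V, hV⟩ ⟨⟨l, hl⟩, W, hW⟩ h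
  obtain rfl : V = W := h
  obtain rfl : k = l := hV.symm.trans hW
  rfl

theorem continuous_starProjection :
    Continuous fun V : NonzeroSubspace n =>
      (V.toSubmodule.starProjection : EuclideanSpace ℂ (Fin n) →L[ℂ] EuclideanSpace ℂ (Fin n)) := by
  rw [continuous_sigma_iff]
  exact fun k => Gr.continuous_starProjection

/-- A subspace is the range of its projection, so the projections separate points. The Hausdorff
property supplies the disjoint neighbourhoods for the covering of unordered by ordered
decompositions. -/
instance : T2Space (NonzeroSubspace n) := by
  refine T2Space.of_injective_continuous ?_ continuous_starProjection
  intro V W h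
  refine toSubmodule_injective ?_
  rw [← Submodule.range_starProjection V.toSubmodule, ← Submodule.range_starProjection W.toSubmodule]
  exact congrArg (fun f : EuclideanSpace ℂ (Fin n) →L[ℂ] EuclideanSpace ℂ (Fin n) =>
    LinearMap.range (f : EuclideanSpace ℂ (Fin n) →ₗ[ℂ] EuclideanSpace ℂ (Fin n))) h

end NonzeroSubspace

namespace IsOrthogonalDecomposition

variable {n m : ℕ} {v w : Fin m → NonzeroSubspace n}

theorem injective (hv : IsOrthogonalDecomposition v) : Function.Injective v := by
  intro i j hij
  by_contra h
  have := hv.1 i j h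
  rw [← hij] at this
  exact (v i).toSubmodule_ne_bot (Submodule.isOrtho_self.1 this)

theorem comp_perm (hv : IsOrthogonalDecomposition v) (σ : Equiv.Perm (Fin m)) :
    IsOrthogonalDecomposition (v ∘ σ) :=
  ⟨fun _ _ hij => hv.1 _ _ (σ.injective.ne hij),
    (σ.iSup_comp (g := fun i => (v i).toSubmodule)).trans hv.2⟩

theorem sum_finrank (hv : IsOrthogonalDecomposition v) :
    ∑ i, Module.finrank ℂ (v i).toSubmodule = n := by
  classical
  have h : OrthogonalFamily ℂ (fun i => (v i).toSubmodule) fun i => (v i).toSubmodule.subtypeₗᵢ :=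
    OrthogonalFamily.of_pairwise fun _ _ hij => hv.1 _ _ hij
  have hI : DirectSum.IsInternal fun i => (v i).toSubmodule := by
    rw [h.isInternal_iff, hv.2, Submodule.top_orthogonal_eq_bot]
  rw [← Module.finrank_directSum,
    (LinearEquiv.ofBijective (DirectSum.coeLinearMap fun i => (v i).toSubmodule) hI).finrank_eq]
  simp

theorem eq_orthogonal (hv : IsOrthogonalDecomposition v) (i : Fin m) :
    (v i).toSubmodule = (⨆ j, ⨆ _ : j ≠ i, (v j).toSubmodule)ᗮ := by
  set K := ⨆ j, ⨆ _ : j ≠ i, (v j).toSubmodule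
  have h1 : (v i).toSubmodule ≤ Kᗮ := by
    refine Submodule.IsOrtho.le ?_
    simp only [K, Submodule.isOrtho_iSup_right]
    exact fun j hj => hv.1 i j hj.symm
  have h2 : (v i).toSubmodule ⊔ K = ⊤ := by
    rw [eq_top_iff, ← hv.2]
    refine iSup_le fun j => ?_
    by_cases hj : j = i
    · rw [hj]; exact le_sup_left
    · exact le_sup_of_le_right (le_iSup₂_of_le j hj le_rfl)
  calc (v i).toSubmodule = (v i).toSubmodule ⊔ K ⊓ Kᗮ := by
        rw [Submodule.inf_orthogonal_eq_bot, sup_bot_eq]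
    _ = ((v i).toSubmodule ⊔ K) ⊓ Kᗮ := (sup_inf_assoc_of_le _ h1).symm
    _ = Kᗮ := by rw [h2, top_inf_eq]

/-- Each member is the orthogonal complement of the span of the others, so one index need not be
checked. -/
theorem eq_of_forall_ne (hv : IsOrthogonalDecomposition v) (hw : IsOrthogonalDecomposition w)
    (i : Fin m) (h : ∀ j, j ≠ i → v j = w j) : v = w := by
  funext j
  by_cases hj : j = i
  · subst hj
    apply NonzeroSubspace.toSubmodule_injective
    rw [hv.eq_orthogonal, hw.eq_orthogonal]
    congr 1
    exact iSup_congr fun k => iSup_congr fun hk => by rw [h k hk]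
  · exact h j hj

end IsOrthogonalDecomposition

/-- The space of ordered orthogonal decompositions of `ℂⁿ` into `m` nonzero subspaces. -/
abbrev OrderedDecomposition (n m : ℕ) : Type :=
  {v : Fin m → NonzeroSubspace n // IsOrthogonalDecomposition v}

namespace OrderedDecomposition

variable {n m : ℕ}

/-- The unordered decomposition that underlies an ordered one. -/
def forget (hm : 1 < m) (v : OrderedDecomposition n m) : ProperDecomposition n :=
  ⟨⟨⟨m, hm⟩, ⟦v.1⟧⟩, v.1, rfl, v.2⟩

theorem continuous_forget (hm : 1 < m) : Continuous (forget (n := n) hm) :=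
  Continuous.subtype_mk (continuous_sigmaMk.comp
    (continuous_quotient_mk'.comp continuous_subtype_val)) _

theorem exists_eq_forget (x : ProperDecomposition n) :
    ∃ (v : OrderedDecomposition n x.1.1.1), x = forget x.1.1.2 v := by
  obtain ⟨⟨⟨m, hm⟩, q⟩, hx⟩ := x
  obtain ⟨v, hq, hv⟩ := id hx
  refine ⟨⟨v, hv⟩, Subtype.ext ?_⟩
  simp only [forget, Sigma.mk.injEq, heq_eq_eq, true_and]
  exact hq

theorem exists_eq_forget_of_card_eq (hm : 1 < m) (x : ProperDecomposition n) (h : x.1.1.1 = m) :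
    ∃ v : OrderedDecomposition n m, x = forget hm v := by
  subst h
  exact exists_eq_forget x

theorem parts_forget (hm : 1 < m) (v : OrderedDecomposition n m) :
    (forget hm v).parts = Set.range fun i => (v.1 i).toSubmodule := rfl

theorem forget_eq_forget_iff (hm : 1 < m) (v w : OrderedDecomposition n m) :
    forget hm v = forget hm w ↔ ∃ σ : Equiv.Perm (Fin m), w.1 = v.1 ∘ σ := by
  constructor
  · intro h
    have h1 := congrArg Subtype.val h
    simp only [forget, Sigma.mk.injEq, heq_eq_eq, true_and] at h1
    exact Quotient.exact h1
  · rintro ⟨σ, h⟩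
    apply Subtype.ext
    simp only [forget, Sigma.mk.injEq, heq_eq_eq, true_and]
    exact Quotient.sound ⟨σ, h⟩

/-- The permutations of the indices act on the ordered decompositions. -/
instance : MulAction (Equiv.Perm (Fin m)) (OrderedDecomposition n m) where
  smul σ v := ⟨v.1 ∘ σ.symm, v.2.comp_perm _⟩
  one_smul _ := rfl
  mul_smul _ _ _ := rfl

theorem smul_apply (σ : Equiv.Perm (Fin m)) (v : OrderedDecomposition n m) (i : Fin m) :
    (σ • v).1 i = v.1 (σ.symm i) := rfl

theorem isOpenMap_mk (X : Type) [TopologicalSpace X] (m : ℕ) :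
    IsOpenMap (Quotient.mk (permSetoid X m)) := by
  intro U hU
  rw [← isQuotientMap_quotient_mk'.isOpen_preimage]
  have : Quotient.mk (permSetoid X m) ⁻¹' (Quotient.mk (permSetoid X m) '' U) =
      ⋃ σ : Equiv.Perm (Fin m), (fun v : Fin m → X => v ∘ σ) ⁻¹' U := by
    ext v
    simp only [Set.mem_preimage, Set.mem_image, Set.mem_iUnion]
    constructor
    · rintro ⟨w, hw, h⟩
      obtain ⟨σ, rfl⟩ := Quotient.exact h.symm
      exact ⟨σ, hw⟩
    · rintro ⟨σ, hσ⟩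
      exact ⟨_, hσ, Quotient.sound ((permSetoid X m).symm ⟨σ, rfl⟩)⟩
  exact this ▸ isOpen_iUnion fun σ =>
    hU.preimage (continuous_pi fun i => continuous_apply (σ i))

/-- The space of ordered decompositions is a covering space of that of unordered ones. -/
theorem isQuotientCoveringMap_mk :
    IsQuotientCoveringMap (fun v : OrderedDecomposition n m =>
      (⟨⟦v.1⟧, v.1, rfl, v.2⟩ : {q : UnorderedTuple (NonzeroSubspace n) m //
        ∃ v, q = ⟦v⟧ ∧ IsOrthogonalDecomposition v})) (Equiv.Perm (Fin m)) := by
  have hq : IsOpenQuotientMap (Quotient.mk (permSetoid (NonzeroSubspace n) m)) :=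
    ⟨Quotient.mk_surjective, continuous_quotient_mk', isOpenMap_mk _ m⟩
  have hcont : Continuous (fun v : OrderedDecomposition n m =>
      (⟨⟦v.1⟧, v.1, rfl, v.2⟩ : {q : UnorderedTuple (NonzeroSubspace n) m //
        ∃ v, q = ⟦v⟧ ∧ IsOrthogonalDecomposition v})) :=
    (hq.continuous.comp continuous_subtype_val).subtype_mk _
  refine
    { toIsQuotientMap := ?_
      continuous_const_smul := fun σ => ?_
      apply_eq_iff_mem_orbit := ?_
      disjoint := fun v => ?_ }
  · refine IsOpenMap.isQuotientMap ?_ hcont ?_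
    · intro U hU
      obtain ⟨W, hW, rfl⟩ := isOpen_induced_iff.1 hU
      refine isOpen_induced_iff.2 ⟨_, hq.isOpenMap W hW, ?_⟩
      ext ⟨q, v, rfl, hv⟩
      simp only [Set.mem_preimage, Set.mem_image]
      constructor
      · rintro ⟨w, hw, h⟩
        obtain ⟨σ, rfl⟩ := Quotient.exact h.symm
        exact ⟨⟨_, hv.comp_perm σ⟩, hw, Subtype.ext h⟩
      · rintro ⟨w, hw, h⟩
        exact ⟨w.1, hw, congrArg Subtype.val h⟩
    · rintro ⟨q, v, rfl, hv⟩
      exact ⟨⟨v, hv⟩, rfl⟩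
  · refine Continuous.subtype_mk (continuous_pi fun i => ?_) _
    exact show Continuous fun v : OrderedDecomposition n m => v.1 (σ.symm i) from
      (continuous_apply (σ.symm i)).comp continuous_subtype_val
  · intro v w
    rw [Subtype.mk.injEq]
    constructor
    · intro h
      obtain ⟨σ, h⟩ := Quotient.exact h
      refine ⟨σ, Subtype.ext ?_⟩
      change w.1 ∘ σ.symm = v.1
      rw [h]
      funext i
      simp
    · rintro ⟨σ, rfl⟩
      refine Quotient.sound ⟨σ, ?_⟩
      funext i
      change w.1 i = w.1 (σ.symm (σ i))
      simp
  -- The members of `v` are distinct and have disjoint neighbourhoods. A tuple whose entries stay in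
  -- these neighbourhoods leaves the set under every nontrivial permutation.
  · have hfin : (Set.range v.1).Finite := Set.finite_range _
    obtain ⟨N, hN, hdisj⟩ := hfin.t2_separation
    refine ⟨{w | ∀ i, w.1 i ∈ N (v.1 i)}, ?_, ?_⟩
    · refine IsOpen.mem_nhds ?_ fun i => (hN _).1
      simp only [Set.ofPred_forall]
      exact isOpen_iInter_of_finite fun i => (hN (v.1 i)).2.preimage
        ((continuous_apply i).comp continuous_subtype_val)
    · rintro σ ⟨_, ⟨w, hw, rfl⟩, hw'⟩
      refine Equiv.ext fun i => ?_
      by_contra hne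
      have h1 := hw i
      have h2 : w.1 i ∈ N (v.1 (σ i)) := by
        have := hw' (σ i)
        change w.1 (σ.symm (σ i)) ∈ _ at this
        rwa [σ.symm_apply_apply] at this
      exact Set.disjoint_left.1
        (hdisj ⟨_, rfl⟩ ⟨_, rfl⟩ (v.2.injective.ne (Ne.symm hne))) h1 h2

/-- Paths of unordered decompositions into a fixed number of subspaces lift to paths of ordered
decompositions. -/
theorem exists_path_lift (hm : 1 < m) (p : C(unitInterval, ProperDecomposition n))
    (hp : ∀ t, (p t).1.1.1 = m) (v : OrderedDecomposition n m) (hv : p 0 = forget hm v) :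
    ∃ p' : C(unitInterval, OrderedDecomposition n m), (∀ t, p t = forget hm (p' t)) ∧ p' 0 = v := by
  -- The chosen `w` need not be continuous, but its class `q` is, because the `m`th summand is
  -- openly embedded in the disjoint union.
  choose w hw using fun t => exists_eq_forget_of_card_eq hm (p t) (hp t)
  let q : unitInterval → {q : UnorderedTuple (NonzeroSubspace n) m //
        ∃ v, q = ⟦v⟧ ∧ IsOrthogonalDecomposition v} := fun t => ⟨⟦(w t).1⟧, (w t).1, rfl, (w t).2⟩
  have hq : Continuous q := by
    refine Continuous.subtype_mk ?_ _
    rw [(Topology.IsOpenEmbedding.sigmaMk (σ := fun m : {m : ℕ // 1 < m} =>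
      UnorderedTuple (NonzeroSubspace n) m.1) (i := ⟨m, hm⟩)).isInducing.continuous_iff]
    have : Continuous fun t => (p t).1 := continuous_subtype_val.comp p.continuous
    simp only [hw] at this
    exact this
  have h0 : q 0 = ⟨⟦v.1⟧, v.1, rfl, v.2⟩ := by
    have := congrArg Subtype.val ((hw 0).symm.trans hv)
    simp only [forget, Sigma.mk.injEq, heq_eq_eq, true_and] at this
    exact Subtype.ext this
  obtain ⟨p', hp', hp'0⟩ :=
    (isQuotientCoveringMap_mk (n := n) (m := m)).isCoveringMap.exists_path_lifts ⟨q, hq⟩ v h0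
  refine ⟨p', fun t => ?_, hp'0⟩
  have h1 := congrArg Subtype.val (congrFun hp' t)
  rw [hw t]
  apply Subtype.ext
  simp only [forget, Sigma.mk.injEq, heq_eq_eq, true_and]
  exact h1.symm

end OrderedDecomposition

/-- A line, as a point of the disjoint union of Grassmannians. -/
def NonzeroSubspace.ofLine {n : ℕ} (L : Gr n 1) : NonzeroSubspace n := ⟨⟨1, le_rfl⟩, L⟩

theorem NonzeroSubspace.continuous_ofLine {n : ℕ} :
    Continuous (ofLine : Gr n 1 → NonzeroSubspace n) :=
  continuous_sigmaMk (σ := fun k : {k : ℕ // 1 ≤ k} => Gr n k.1) (i := ⟨1, le_rfl⟩)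

theorem NonzeroSubspace.ofLine_injective {n : ℕ} :
    Function.Injective (ofLine : Gr n 1 → NonzeroSubspace n) :=
  sigma_mk_injective (β := fun k : {k : ℕ // 1 ≤ k} => Gr n k.1) (i := ⟨1, le_rfl⟩)

/-- The space of ordered triples of mutually orthogonal lines in `ℂ³`. -/
abbrev OrthogonalFrame : Type := OrderedDecomposition 3 3

-- Path connectedness of the space of orthogonal frames

namespace OrthogonalFrame

open NonzeroSubspace

theorem finrank_eq_one (g : OrthogonalFrame) (i : Fin 3) :
    Module.finrank ℂ (g.1 i).toSubmodule = 1 := by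
  have h := g.2.sum_finrank
  have h1 : ∀ i, 1 ≤ Module.finrank ℂ (g.1 i).toSubmodule := fun i => by
    rw [finrank_toSubmodule]; exact (g.1 i).1.2
  rw [Fin.sum_univ_three] at h
  have := h1 0
  have := h1 1
  have := h1 2
  fin_cases i <;> simp only [Fin.zero_eta, Fin.mk_one, Fin.reduceFinMk] <;> omega

/-- The lines of an orthogonal frame. -/
def lineAt (i : Fin 3) (g : OrthogonalFrame) : Gr 3 1 := ⟨(g.1 i).toSubmodule, finrank_eq_one g i⟩

theorem ofLine_lineAt (g : OrthogonalFrame) (i : Fin 3) : ofLine (lineAt i g) = g.1 i :=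
  toSubmodule_injective rfl

theorem continuous_lineAt (i : Fin 3) : Continuous (lineAt i) :=
  Gr.continuous_of_starProjection (NonzeroSubspace.continuous_starProjection.comp
    ((continuous_apply i).comp continuous_subtype_val))

theorem isOrtho_lineAt (g : OrthogonalFrame) {i j : Fin 3} (h : i ≠ j) :
    (lineAt i g).1 ⟂ (lineAt j g).1 := g.2.1 i j h

/-- The space of orthogonal bases of `ℂ³`. -/
abbrev OrthogonalBasis : Type :=
  {u : Fin 3 → EuclideanSpace ℂ (Fin 3) // (∀ i, u i ≠ 0) ∧ ∀ i j, i ≠ j → inner ℂ (u i) (u j) = 0}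

/-- The frame of lines spanned by the members of an orthogonal basis. -/
def ofBasis (u : OrthogonalBasis) : OrthogonalFrame :=
  ⟨fun i => ofLine (Gr.line ⟨u.1 i, u.2.1 i⟩), by
    constructor
    · intro i j hij
      exact Submodule.isOrtho_span.2 (by simpa using u.2.2 i j hij)
    · have h := (linearIndependent_of_ne_zero_of_inner_eq_zero u.2.1
        (fun i j hij => u.2.2 i j hij)).span_eq_top_of_card_eq_finrank' (by simp)
      rw [← h, Submodule.span_range_eq_iSup]
      rfl⟩

theorem continuous_ofBasis : Continuous ofBasis := by
  refine Continuous.subtype_mk (continuous_pi fun i => ?_) _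
  refine continuous_ofLine.comp (Gr.continuous_line.comp (Continuous.subtype_mk ?_ _))
  exact (continuous_apply i).comp continuous_subtype_val

theorem exists_unit_vector (L : Gr 3 1) :
    ∃ (v : EuclideanSpace ℂ (Fin 3)) (h : v ≠ 0), ‖v‖ = 1 ∧ L = Gr.line ⟨v, h⟩ := by
  obtain ⟨⟨v, hv⟩, rfl⟩ := Gr.exists_eq_line L
  have hn : ((‖v‖ : ℝ) : ℂ)⁻¹ • v ≠ 0 := smul_ne_zero (by simpa using hv) hv
  refine ⟨((‖v‖ : ℝ) : ℂ)⁻¹ • v, hn, ?_, Gr.eq_line_of_mem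
    (Submodule.smul_mem _ _ (Submodule.mem_span_singleton_self _)) hn⟩
  rw [norm_smul]
  simp [hv]

/-- The frame of lines spanned by the members of an orthonormal basis. -/
noncomputable def ofOrthonormalBasis (b : OrthonormalBasis (Fin 3) ℂ (EuclideanSpace ℂ (Fin 3))) :
    OrthogonalFrame :=
  ofBasis ⟨b, fun i => b.orthonormal.ne_zero i, fun _ _ h => b.orthonormal.2 h⟩

theorem exists_eq_ofOrthonormalBasis (g : OrthogonalFrame) :
    ∃ b, g = ofOrthonormalBasis b := by
  choose v h0 hv hL using fun i => exists_unit_vector (lineAt i g)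
  have hon : Orthonormal ℂ v := by
    refine ⟨hv, fun i j hij => ?_⟩
    have h := isOrtho_lineAt g hij
    rw [hL i, hL j] at h
    exact h.inner_eq (Submodule.mem_span_singleton_self _) (Submodule.mem_span_singleton_self _)
  obtain ⟨b, hb⟩ := Orthonormal.exists_orthonormalBasis_extension_of_card_eq (ι := Fin 3)
    (by simp) (v := v) (s := Set.univ) (hon.comp _ Subtype.val_injective)
  refine ⟨b, Subtype.ext (funext fun i => ?_)⟩
  rw [← ofLine_lineAt, hL i]
  exact congrArg ofLine (Subtype.ext (by simp only [Gr.line, hb i (Set.mem_univ i)]))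

theorem exists_of_isOrtho {L M : Gr 3 1} (h : L.1 ⟂ M.1) {i j : Fin 3} (hij : i ≠ j) :
    ∃ g : OrthogonalFrame, g.1 i = ofLine L ∧ g.1 j = ofLine M := by
  obtain ⟨x, hx0, hx, rfl⟩ := exists_unit_vector L
  obtain ⟨y, hy0, hy, rfl⟩ := exists_unit_vector M
  have hxy : inner ℂ x y = 0 :=
    h.inner_eq (Submodule.mem_span_singleton_self _) (Submodule.mem_span_singleton_self _)
  let v : Fin 3 → EuclideanSpace ℂ (Fin 3) := fun k => if k = i then x else y
  have hvi : v i = x := if_pos rfl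
  have hvj : v j = y := if_neg hij.symm
  have hon : Orthonormal ℂ (Set.domRestrict {i, j} v) := by
    constructor
    · rintro ⟨k, rfl | rfl⟩
      · change ‖v k‖ = 1; rw [hvi, hx]
      · change ‖v k‖ = 1; rw [hvj, hy]
    · rintro ⟨k, rfl | rfl⟩ ⟨l, rfl | rfl⟩ hkl
      · exact absurd rfl hkl
      · change inner ℂ (v k) (v l) = 0; rw [hvi, hvj, hxy]
      · change inner ℂ (v k) (v l) = 0; rw [hvi, hvj]; exact inner_eq_zero_symm.1 hxy
      · exact absurd rfl hkl
  obtain ⟨b, hb⟩ := Orthonormal.exists_orthonormalBasis_extension_of_card_eq (ι := Fin 3)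
    (by simp) (v := v) (s := {i, j}) hon
  refine ⟨ofOrthonormalBasis b, congrArg ofLine (Subtype.ext ?_), congrArg ofLine (Subtype.ext ?_)⟩
  · simp only [Gr.line, hb i (by simp), hvi]
  · simp only [Gr.line, hb j (by simp), hvj]

theorem exists_line_isOrtho (L M : Gr 3 1) : ∃ N : Gr 3 1, N.1 ⟂ L.1 ∧ N.1 ⟂ M.1 := by
  obtain ⟨v, hv, h0⟩ := Submodule.exists_mem_ne_zero_of_ne_bot (p := (L.1 ⊔ M.1)ᗮ) (by
    intro h
    rw [Submodule.orthogonal_eq_bot_iff] at h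
    have h1 := Submodule.finrank_add_le_finrank_add_finrank L.1 M.1
    rw [h, finrank_top, L.2, M.2, finrank_euclideanSpace_fin] at h1
    norm_num at h1)
  have h1 : (Gr.line ⟨v, h0⟩).1 ≤ (L.1 ⊔ M.1)ᗮ := (Submodule.span_singleton_le_iff_mem _ _).2 hv
  have h2 : (Gr.line ⟨v, h0⟩).1 ⟂ L.1 ⊔ M.1 := h1
  exact ⟨_, h2.mono_right le_sup_left, h2.mono_right le_sup_right⟩

theorem exists_lineAt_eq (L : Gr 3 1) (i : Fin 3) : ∃ g, lineAt i g = L := by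
  obtain ⟨N, hN, -⟩ := exists_line_isOrtho L L
  obtain ⟨j, hj⟩ : ∃ j : Fin 3, i ≠ j := ⟨i + 1, by revert i; decide⟩
  obtain ⟨g, hg, -⟩ := exists_of_isOrtho hN.symm hj
  exact ⟨g, ofLine_injective ((ofLine_lineAt g i).trans hg)⟩

/-- Frames with a common last line are joined by a rotation of the plane orthogonal to it. -/
theorem joined_of_last_eq {g g' : OrthogonalFrame} (h : g.1 2 = g'.1 2) : Joined g g' := by
  obtain ⟨b, rfl⟩ := exists_eq_ofOrthonormalBasis g
  obtain ⟨⟨v, hv⟩, hL⟩ := Gr.exists_eq_line (lineAt 0 g')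
  have hv2 : inner ℂ (b 2) v = 0 := by
    have h2 := isOrtho_lineAt g' (i := 2) (j := 0) (by decide)
    have h3 : lineAt 2 g' = lineAt 2 (ofOrthonormalBasis b) :=
      ofLine_injective (by rw [ofLine_lineAt, ofLine_lineAt, h])
    rw [h3, hL] at h2
    exact h2.inner_eq (Submodule.mem_span_singleton_self _) (Submodule.mem_span_singleton_self _)
  have hsum : inner ℂ (b 0) v • b 0 + inner ℂ (b 1) v • b 1 = v := by
    have := b.sum_repr' v
    rwa [Fin.sum_univ_three, hv2, zero_smul, add_zero] at this
  have hb : ∀ i j, inner ℂ (b i) (b j) = if i = j then 1 else 0 := b.inner_eq_ite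
  -- A nonzero `z` gives a vector in the plane of `b 0` and `b 1`, completed by an orthogonal vector
  -- that depends continuously on `z`. The parameter space `ℂ²` minus the origin is path connected.
  let u : ℂ × ℂ → Fin 3 → EuclideanSpace ℂ (Fin 3) := fun z =>
    ![z.1 • b 0 + z.2 • b 1, -(starRingEnd ℂ z.2) • b 0 + starRingEnd ℂ z.1 • b 1, b 2]
  have hu : ∀ z : ℂ × ℂ, z ≠ 0 →
      (∀ i, u z i ≠ 0) ∧ ∀ i j, i ≠ j → inner ℂ (u z i) (u z j) = 0 := by
    intro z hz
    constructor
    · intro i hi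
      have h0 : inner ℂ (b 0) (u z i) = 0 := by rw [hi, inner_zero_right]
      have h1 : inner ℂ (b 1) (u z i) = 0 := by rw [hi, inner_zero_right]
      have h2 : inner ℂ (b 2) (u z i) = 0 := by rw [hi, inner_zero_right]
      fin_cases i <;> simp [u, inner_smul_right, hb] at h0 h1 h2
      · exact hz (Prod.ext h0 h1)
      · exact hz (Prod.ext h1 h0)
    · intro i j hij
      fin_cases i <;> fin_cases j <;>
        simp [u, inner_smul_right, inner_add_left, inner_smul_left, hb] at hij ⊢
      all_goals ring
  let φ : {z : ℂ × ℂ // z ≠ 0} → OrthogonalFrame := fun z => ofBasis ⟨u z.1, hu z.1 z.2⟩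
  have hφ : Continuous φ := by
    refine continuous_ofBasis.comp (Continuous.subtype_mk (continuous_pi fun i => ?_) _)
    fin_cases i
    · change Continuous fun z : {z : ℂ × ℂ // z ≠ 0} => z.1.1 • b 0 + z.1.2 • b 1
      fun_prop
    · change Continuous fun z : {z : ℂ × ℂ // z ≠ 0} =>
        -(starRingEnd ℂ z.1.2) • b 0 + starRingEnd ℂ z.1.1 • b 1
      fun_prop
    · exact continuous_const
  have hc : IsPathConnected ({0}ᶜ : Set (ℂ × ℂ)) :=
    isPathConnected_compl_singleton_of_one_lt_rank (by
      rw [rank_prod', Complex.rank_real_complex]; norm_num) 0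
  have hpc : PathConnectedSpace {z : ℂ × ℂ // z ≠ 0} :=
    isPathConnected_iff_pathConnectedSpace.1 hc
  have key : ∀ z, z ∈ Set.range φ → ∀ w, w ∈ Set.range φ → Joined z w := by
    rintro _ ⟨z, rfl⟩ _ ⟨w, rfl⟩
    exact (hpc.joined z w).map hφ
  refine key _ ⟨⟨(1, 0), by simp⟩, ?_⟩ _ ⟨⟨(inner ℂ (b 0) v, inner ℂ (b 1) v), ?_⟩, ?_⟩
  · refine Subtype.ext (funext fun i => congrArg ofLine (Subtype.ext ?_))
    fin_cases i <;> simp [Gr.line, u]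
  · intro h0
    rw [Prod.mk_eq_zero] at h0
    rw [h0.1, h0.2, zero_smul, zero_smul, zero_add] at hsum
    exact hv hsum.symm
  · refine Subtype.ext (IsOrthogonalDecomposition.eq_of_forall_ne (Subtype.prop _) g'.2 1 ?_)
    intro j hj
    fin_cases j
    · refine Eq.trans ?_ (ofLine_lineAt g' 0)
      rw [hL]
      refine congrArg ofLine (Subtype.ext ?_)
      simp [Gr.line, u, hsum]
    · exact absurd rfl hj
    · exact h

theorem joined_smul (τ : Equiv.Perm (Fin 3)) {g g' : OrthogonalFrame} (h : Joined g g') :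
    Joined (τ • g) (τ • g') :=
  h.map (OrderedDecomposition.isQuotientCoveringMap_mk.toContinuousConstSMul.continuous_const_smul τ)

theorem joined_of_eq {g g' : OrthogonalFrame} (i : Fin 3) (h : g.1 i = g'.1 i) : Joined g g' := by
  have h1 : Joined (Equiv.swap i 2 • g) (Equiv.swap i 2 • g') := by
    refine joined_of_last_eq ?_
    rw [OrderedDecomposition.smul_apply, OrderedDecomposition.smul_apply]
    simpa using h
  simpa using joined_smul (Equiv.swap i 2)⁻¹ h1

/-- Choose a line `N` orthogonal to the first line of `g` and to the last line of `g'`. Two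
intermediate frames that contain `N` in the middle form a chain from `g` to `g'` in which neighbours
share a line. -/
instance : PathConnectedSpace OrthogonalFrame := by
  refine ⟨⟨(exists_lineAt_eq (Gr.line ⟨EuclideanSpace.single 0 1, by simp⟩) 0).choose⟩,
    fun g g' => ?_⟩
  obtain ⟨N, hN, hN'⟩ := exists_line_isOrtho (lineAt 0 g) (lineAt 2 g')
  obtain ⟨h₁, h10, h11⟩ := exists_of_isOrtho hN.symm (show (0 : Fin 3) ≠ 1 by decide)
  obtain ⟨h₂, h21, h22⟩ := exists_of_isOrtho hN' (show (1 : Fin 3) ≠ 2 by decide)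
  refine (joined_of_eq 0 ?_).trans ((joined_of_eq (g := h₁) (g' := h₂) 1 ?_).trans
    (joined_of_eq 2 ?_))
  · rw [h10, ofLine_lineAt]
  · rw [h11, h21]
  · rw [h22, ofLine_lineAt]

end OrthogonalFrame

-- The two levels of the poset of decompositions of `ℂ³`

namespace ProperDecomposition

open NonzeroSubspace OrderedDecomposition OrthogonalFrame

/-- The plane orthogonal to a line in `ℂ³`. -/
noncomputable def orthogonalPlane (L : Gr 3 1) : Gr 3 2 :=
  ⟨L.1ᗮ, by
    have h := Submodule.finrank_add_finrank_orthogonal L.1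
    rw [L.2, finrank_euclideanSpace_fin] at h
    omega⟩

theorem continuous_orthogonalPlane : Continuous orthogonalPlane := by
  refine Gr.continuous_of_starProjection ?_
  simp only [orthogonalPlane, Submodule.starProjection_orthogonal']
  exact continuous_const.sub Gr.continuous_starProjection

/-- The ordered decomposition of `ℂ³` into a line and the orthogonal plane. -/
noncomputable def orderedOfLine (L : Gr 3 1) : OrderedDecomposition 3 2 :=
  ⟨![ofLine L, ⟨⟨2, one_le_two⟩, orthogonalPlane L⟩], by
    constructor
    · intro i j hij
      fin_cases i <;> fin_cases j
      · exact absurd rfl hij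
      · exact Submodule.isOrtho_orthogonal_right L.1
      · exact Submodule.isOrtho_orthogonal_left L.1
      · exact absurd rfl hij
    · refine eq_top_iff.2 ((Submodule.sup_orthogonal_of_hasOrthogonalProjection (K := L.1)).ge.trans
        (sup_le ?_ ?_))
      · exact le_iSup_of_le (0 : Fin 2) le_rfl
      · exact le_iSup_of_le (1 : Fin 2) le_rfl⟩

/-- The decomposition of `ℂ³` into a line and the orthogonal plane. -/
noncomputable def ofLine (L : Gr 3 1) : ProperDecomposition 3 := forget one_lt_two (orderedOfLine L)

/-- The decomposition of `ℂ³` into the lines of an orthogonal frame. -/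
def ofFrame (g : OrthogonalFrame) : ProperDecomposition 3 := forget (by norm_num) g

theorem continuous_ofLine : Continuous ofLine := by
  refine (continuous_forget _).comp (Continuous.subtype_mk (continuous_pi fun i => ?_) _)
  fin_cases i
  · exact NonzeroSubspace.continuous_ofLine
  · exact (continuous_sigmaMk (σ := fun k : {k : ℕ // 1 ≤ k} => Gr 3 k.1)
      (i := ⟨2, one_le_two⟩)).comp continuous_orthogonalPlane

theorem continuous_ofFrame : Continuous ofFrame := continuous_forget _

/-- Whether a decomposition of `ℂ³` has two members. -/
def isPair (x : ProperDecomposition 3) : Bool := decide (x.1.1.1 = 2)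

theorem continuous_isPair : Continuous isPair := by
  have h : Continuous fun x : Σ m : {m : ℕ // 1 < m}, UnorderedTuple (NonzeroSubspace 3) m.1 =>
      decide (x.1.1 = 2) := by
    rw [continuous_sigma_iff]
    exact fun m => continuous_of_const fun _ _ => rfl
  exact h.comp continuous_subtype_val

theorem isPair_ofLine (L : Gr 3 1) : isPair (ofLine L) = true := rfl

theorem isPair_ofFrame (g : OrthogonalFrame) : isPair (ofFrame g) = false := rfl

/-- Two positive dimensions with sum 3 are 1 and 2; a swap puts the line first. -/
theorem exists_eq_ofLine {x : ProperDecomposition 3} (hx : isPair x = true) :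
    ∃ L, x = ofLine L := by
  obtain ⟨v, rfl⟩ := exists_eq_forget_of_card_eq one_lt_two x (of_decide_eq_true hx)
  have hs := v.2.sum_finrank
  rw [Fin.sum_univ_two] at hs
  have h0 := (v.1 0).1.2
  have h1 := (v.1 1).1.2
  rw [← finrank_toSubmodule] at h0 h1
  have key : ∀ i : Fin 2, Module.finrank ℂ (v.1 i).toSubmodule = 1 →
      ∃ L, forget one_lt_two v = ofLine L := by
    intro i hi
    let L : Gr 3 1 := ⟨(v.1 i).toSubmodule, hi⟩
    refine ⟨L, (forget_eq_forget_iff _ _ _).2 ⟨Equiv.swap 0 i, ?_⟩⟩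
    refine IsOrthogonalDecomposition.eq_of_forall_ne (orderedOfLine L).2 (v.2.comp_perm _) 1 ?_
    intro j hj
    obtain rfl : j = 0 := by revert hj; revert j; decide
    refine toSubmodule_injective ?_
    simp [orderedOfLine, L]
    rfl
  rcases (by omega : Module.finrank ℂ (v.1 0).toSubmodule = 1 ∨
    Module.finrank ℂ (v.1 1).toSubmodule = 1) with h | h
  · exact key 0 h
  · exact key 1 h

theorem card_le_three (x : ProperDecomposition 3) : x.1.1.1 ≤ 3 := by
  obtain ⟨v, -⟩ := exists_eq_forget x
  refine le_trans ?_ v.2.sum_finrank.le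
  calc x.1.1.1 = ∑ _i : Fin x.1.1.1, 1 := by simp
    _ ≤ _ := Finset.sum_le_sum fun i _ => by rw [finrank_toSubmodule]; exact (v.1 i).1.2

theorem card_eq_three {x : ProperDecomposition 3} (hx : isPair x = false) : x.1.1.1 = 3 := by
  have h1 := card_le_three x
  have h2 := x.1.1.2
  have h3 := of_decide_eq_false hx
  omega

theorem exists_eq_ofFrame {x : ProperDecomposition 3} (hx : isPair x = false) :
    ∃ g, x = ofFrame g :=
  exists_eq_forget_of_card_eq _ x (card_eq_three hx)

theorem mem_parts_ofLine {L : Gr 3 1} {V : Submodule ℂ (EuclideanSpace ℂ (Fin 3))} :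
    V ∈ (ofLine L).parts ↔ V = L.1 ∨ V = L.1ᗮ := by
  rw [ofLine, parts_forget, Set.mem_range]
  constructor
  · rintro ⟨i, rfl⟩
    fin_cases i
    exacts [Or.inl rfl, Or.inr rfl]
  · rintro (rfl | rfl)
    exacts [⟨0, rfl⟩, ⟨1, rfl⟩]

theorem mem_parts_ofFrame {g : OrthogonalFrame} {V : Submodule ℂ (EuclideanSpace ℂ (Fin 3))} :
    V ∈ (ofFrame g).parts ↔ ∃ i, (lineAt i g).1 = V := Iff.rfl

theorem finrank_orthogonal (L : Gr 3 1) : Module.finrank ℂ ↥L.1ᗮ = 2 := (orthogonalPlane L).2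

theorem not_orthogonal_le (L M : Gr 3 1) : ¬ L.1ᗮ ≤ M.1 := fun h => by
  have := Submodule.finrank_mono h
  rw [finrank_orthogonal, M.2] at this
  omega

theorem eq_of_le {k : ℕ} {V W : Gr 3 k} (h : V.1 ≤ W.1) : V = W :=
  Subtype.ext (Submodule.eq_of_le_of_finrank_eq h (V.2.trans W.2.symm))

theorem ofLine_le_ofLine {L M : Gr 3 1} (h : ofLine L ≤ ofLine M) : L = M := by
  obtain ⟨W, hW, hLW⟩ := h _ (mem_parts_ofLine.2 (Or.inr rfl))
  rcases mem_parts_ofLine.1 hW with rfl | rfl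
  · exact absurd hLW (not_orthogonal_le L M)
  · have := congrArg Subtype.val (eq_of_le (V := orthogonalPlane L) (W := orthogonalPlane M) hLW)
    refine Subtype.ext ?_
    rw [← Submodule.orthogonal_orthogonal L.1, ← Submodule.orthogonal_orthogonal M.1]
    exact congrArg Submodule.orthogonal this

theorem ofLine_injective : Function.Injective ofLine := fun _ _ h => ofLine_le_ofLine h.le

theorem not_ofLine_le_ofFrame (L : Gr 3 1) (g : OrthogonalFrame) : ¬ ofLine L ≤ ofFrame g := by
  intro h
  obtain ⟨W, hW, hLW⟩ := h _ (mem_parts_ofLine.2 (Or.inr rfl))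
  obtain ⟨i, rfl⟩ := mem_parts_ofFrame.1 hW
  exact not_orthogonal_le _ _ hLW

theorem ofFrame_le_ofLine_lineAt (g : OrthogonalFrame) (i : Fin 3) :
    ofFrame g ≤ ofLine (lineAt i g) := by
  intro V hV
  obtain ⟨j, rfl⟩ := mem_parts_ofFrame.1 hV
  by_cases hij : j = i
  · exact ⟨_, mem_parts_ofLine.2 (Or.inl rfl), hij ▸ le_rfl⟩
  · exact ⟨_, mem_parts_ofLine.2 (Or.inr rfl), (isOrtho_lineAt g hij).le⟩

/-- Otherwise all three lines would lie in the plane orthogonal to `L`, although they span `ℂ³`. -/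
theorem exists_lineAt_eq_of_le {g : OrthogonalFrame} {L : Gr 3 1} (h : ofFrame g ≤ ofLine L) :
    ∃ i, lineAt i g = L := by
  by_contra! hne
  have h1 : ∀ i, (lineAt i g).1 ≤ L.1ᗮ := by
    intro i
    obtain ⟨W, hW, hi⟩ := h _ (mem_parts_ofFrame.2 ⟨i, rfl⟩)
    rcases mem_parts_ofLine.1 hW with rfl | rfl
    · exact absurd (eq_of_le hi) (hne i)
    · exact hi
  have h2 : (⊤ : Submodule ℂ (EuclideanSpace ℂ (Fin 3))) ≤ L.1ᗮ := g.2.2.ge.trans (iSup_le h1)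
  have h3 := Submodule.finrank_mono h2
  rw [finrank_orthogonal, finrank_top, finrank_euclideanSpace_fin] at h3
  omega

theorem ofFrame_eq_ofFrame_iff {g h : OrthogonalFrame} :
    ofFrame g = ofFrame h ↔ ∃ τ : Equiv.Perm (Fin 3), h.1 = g.1 ∘ τ :=
  forget_eq_forget_iff _ _ _

theorem ofFrame_smul (τ : Equiv.Perm (Fin 3)) (g : OrthogonalFrame) :
    ofFrame (τ • g) = ofFrame g :=
  (ofFrame_eq_ofFrame_iff.2 ⟨τ.symm, rfl⟩).symm

theorem ofFrame_le_ofFrame {g h : OrthogonalFrame} (hle : ofFrame g ≤ ofFrame h) :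
    ofFrame g = ofFrame h := by
  have h1 : ∀ i, ∃ j, g.1 i = h.1 j := by
    intro i
    obtain ⟨W, hW, hi⟩ := hle _ (mem_parts_ofFrame.2 ⟨i, rfl⟩)
    obtain ⟨j, rfl⟩ := mem_parts_ofFrame.1 hW
    exact ⟨j, by rw [← ofLine_lineAt, ← ofLine_lineAt, eq_of_le hi]⟩
  choose f hf using h1
  have hinj : Function.Injective f := fun i j hij =>
    g.2.injective (by rw [hf, hf, hij])
  exact (ofFrame_eq_ofFrame_iff.2
    ⟨Equiv.ofBijective f (Finite.injective_iff_bijective.1 hinj), funext hf⟩).symm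

theorem monotone_isPair : Monotone isPair := by
  intro x y hxy
  cases hy : isPair y
  · cases hx : isPair x
    · exact le_rfl
    · obtain ⟨L, rfl⟩ := exists_eq_ofLine hx
      obtain ⟨g, rfl⟩ := exists_eq_ofFrame hy
      exact absurd hxy (not_ofLine_le_ofFrame L g)
  · exact Bool.le_true _

theorem eq_of_le_of_isPair_eq (x y : ProperDecomposition 3) (hxy : x ≤ y)
    (h : isPair x = isPair y) : x = y := by
  cases hx : isPair x
  · obtain ⟨g, rfl⟩ := exists_eq_ofFrame hx
    obtain ⟨g', rfl⟩ := exists_eq_ofFrame (h.symm.trans hx)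
    exact ofFrame_le_ofFrame hxy
  · obtain ⟨L, rfl⟩ := exists_eq_ofLine hx
    obtain ⟨M, rfl⟩ := exists_eq_ofLine (h.symm.trans hx)
    rw [ofLine_le_ofLine hxy]

/-- The sum of the projections onto the lines in an unordered tuple of subspaces. -/
noncomputable def lineProjection {n m : ℕ} (q : UnorderedTuple (NonzeroSubspace n) m) :
    EuclideanSpace ℂ (Fin n) →L[ℂ] EuclideanSpace ℂ (Fin n) :=
  Quotient.lift (fun v => ∑ i, if (v i).1.1 = 1 then (v i).toSubmodule.starProjection else 0)
    (by
      rintro v w ⟨τ, rfl⟩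
      exact (Equiv.sum_comp τ fun i =>
        if (v i).1.1 = 1 then (v i).toSubmodule.starProjection else 0).symm) q

/-- This recovers the line continuously from a decomposition into a line and a plane, so that paths
in the upper level come from paths of lines. -/
theorem continuous_lineProjection {n : ℕ} :
    Continuous fun x : ProperDecomposition n => lineProjection x.1.2 := by
  have h1 : Continuous fun V : NonzeroSubspace n =>
      if V.1.1 = 1 then V.toSubmodule.starProjection else 0 := by
    rw [continuous_sigma_iff]
    intro k
    by_cases hk : k.1 = 1
    · simp only [hk, if_true]
      exact NonzeroSubspace.continuous_starProjection.comp
        (continuous_sigmaMk (σ := fun k : {k : ℕ // 1 ≤ k} => Gr n k.1))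
    · simp only [hk, if_false]
      exact continuous_const
  have h2 : Continuous fun x : Σ m : {m : ℕ // 1 < m}, UnorderedTuple (NonzeroSubspace n) m.1 =>
      lineProjection x.2 := by
    rw [continuous_sigma_iff]
    intro m
    have h3 : Continuous fun v : Fin m.1 → NonzeroSubspace n =>
        ∑ i, if (v i).1.1 = 1 then (v i).toSubmodule.starProjection else 0 :=
      continuous_finsetSum _ fun i _ => h1.comp (continuous_apply i)
    have h4 : Continuous (lineProjection (n := n) (m := m.1)) := by
      unfold lineProjection
      exact h3.quotient_lift _
    exact h4
  exact h2.comp continuous_subtype_val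

theorem lineProjection_ofLine (L : Gr 3 1) :
    lineProjection (ofLine L).1.2 = L.1.starProjection := by
  change ∑ i : Fin 2, (if ((orderedOfLine L).1 i).1.1 = 1 then
    ((orderedOfLine L).1 i).toSubmodule.starProjection else 0) = _
  rw [Fin.sum_univ_two]
  change (if 1 = 1 then L.1.starProjection else 0) + (if 2 = 1 then _ else 0) = L.1.starProjection
  simp

/-- A frame lies below the pair of a line only if that line is one of its own, and reordering the
frame makes it the first. So the ordered frames map onto the strict inequalities. -/
theorem isPathConnected_morphisms :
    IsPathConnected {y : NerveSimplices (ProperDecomposition 3) 1 |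
      isPair (y.1 0) = false ∧ isPair (y.1 1) = true} := by
  have hc : Continuous fun g : OrthogonalFrame =>
      NerveSimplices.pair (ofFrame_le_ofLine_lineAt g 0) := by
    refine Continuous.subtype_mk (continuous_pi fun i => ?_) _
    fin_cases i
    exacts [continuous_ofFrame, continuous_ofLine.comp (continuous_lineAt 0)]
  convert isPathConnected_range hc using 1
  ext y
  constructor
  · rintro ⟨h0, h1⟩
    obtain ⟨g, hg⟩ := exists_eq_ofFrame h0
    obtain ⟨L, hL⟩ := exists_eq_ofLine h1
    have hle : ofFrame g ≤ ofLine L := by rw [← hg, ← hL]; exact y.2 (Fin.zero_le 1)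
    obtain ⟨i, rfl⟩ := exists_lineAt_eq_of_le hle
    refine ⟨Equiv.swap 0 i • g, Subtype.ext (funext fun j => ?_)⟩
    fin_cases j
    · exact (ofFrame_smul _ g).trans hg.symm
    · refine Eq.trans (congrArg ofLine (NonzeroSubspace.ofLine_injective ?_)) hL.symm
      rw [ofLine_lineAt, ofLine_lineAt, smul_apply]
      simp
  · rintro ⟨g, rfl⟩
    exact ⟨isPair_ofFrame g, isPair_ofLine _⟩

end ProperDecomposition

-- Pushing paths up along edges

section Cone

open scoped unitInterval

/-- Paths of objects that lie below paths of objects with common endpoints and homotopic images are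
homotopic in the realization. -/
theorem NerveRealization.homotopic_of_le {P : Type} [Preorder P] [TopologicalSpace P] {a b x y : P}
    {p q : Path a b} {l l' : Path x y} (hp : ∀ t, p t ≤ l t) (hq : ∀ t, q t ≤ l' t)
    (h : (l.map (continuous_vertex (P := P))).Homotopic (l'.map continuous_vertex)) :
    (p.map (continuous_vertex (P := P))).Homotopic (q.map continuous_vertex) := by
  have hax : a ≤ x := by simpa using hp 0
  have hby : b ≤ y := by simpa using hp 1
  let k : ∀ {c d : P} (_ : c ≤ d), Path (vertex c) (vertex d) := fun hcd =>
    { toFun := fun s => edge (NerveSimplices.pair hcd) s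
      continuous_toFun := continuous_edge.comp (continuous_const.prodMk continuous_id)
      source' := edge_zero _
      target' := edge_one _ }
  -- The edges from `p t` up to `l t` fill a square whose vertical sides depend only on the
  -- endpoints.
  have square : ∀ {p : Path a b} {l : Path x y} (_ : ∀ t, p t ≤ l t),
      ((p.map (continuous_vertex (P := P))).trans (k hby)).Homotopic
        ((k hax).trans (l.map continuous_vertex)) := by
    intro p l hp
    have hpair : Continuous fun t : I => NerveSimplices.pair (hp t) := by
      refine Continuous.subtype_mk (continuous_pi fun i => ?_) _
      fin_cases i
      exacts [p.continuous, l.continuous]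
    have hH : Continuous fun z : I × I => edge (NerveSimplices.pair (hp z.2)) z.1 :=
      continuous_edge.comp ((hpair.comp continuous_snd).prodMk continuous_fst)
    refine Path.Homotopic.of_square ⟨_, hH⟩ (fun t => edge_zero _) (fun t => edge_one _)
      (fun s => ?_) (fun s => ?_)
    · change edge _ s = edge _ s
      congr 1
      simp only [NerveSimplices.pair, p.source, l.source]
    · change edge _ s = edge _ s
      congr 1
      simp only [NerveSimplices.pair, p.target, l.target]
  exact Path.Homotopic.of_trans_homotopic (square hp) (square hq) h

end Cone

-- Paths of objects are determined by their endpoints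

namespace ProperDecomposition

open OrderedDecomposition OrthogonalFrame NerveRealization

theorem isPair_path {a b : ProperDecomposition 3} (p : Path a b) (t : unitInterval) :
    isPair (p t) = isPair a := by
  have h := PreconnectedSpace.constant inferInstance (continuous_isPair.comp p.continuous)
    (x := t) (y := 0)
  simpa using h

theorem exists_lift_to_lines {a b : ProperDecomposition 3} (ha : isPair a = true) (p : Path a b) :
    ∃ p' : C(unitInterval, Gr 3 1), ∀ t, ofLine (p' t) = p t := by
  choose L hL using fun t => exists_eq_ofLine ((isPair_path p t).trans ha)
  refine ⟨⟨L, Gr.continuous_of_starProjection ?_⟩, fun t => (hL t).symm⟩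
  have h := continuous_lineProjection.comp p.continuous
  convert h using 1
  funext t
  rw [Function.comp_apply, hL t, lineProjection_ofLine]

theorem homotopic_of_isPair {a b : ProperDecomposition 3} (ha : isPair a = true) (p q : Path a b) :
    (p.map (continuous_vertex (P := ProperDecomposition 3))).Homotopic
      (q.map continuous_vertex) := by
  obtain ⟨p', hp⟩ := exists_lift_to_lines ha p
  obtain ⟨q', hq⟩ := exists_lift_to_lines ha q
  refine Path.Homotopic.of_lifts ⟨_, continuous_vertex.comp continuous_ofLine⟩ _ _ p' q'
    (fun t => congrArg vertex (hp t)) (fun t => congrArg vertex (hq t)) ?_ ?_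
  · exact ofLine_injective (by rw [hp, hq, p.source, q.source])
  · exact ofLine_injective (by rw [hp, hq, p.target, q.target])

/-- The paths of `i`th lines have common endpoints, hence are homotopic in the realization; `p` and
`q` lie below them. -/
theorem homotopic_of_lineAt_eq {a b : ProperDecomposition 3} {p q : Path a b}
    (p' q' : C(unitInterval, OrthogonalFrame)) (hp : ∀ t, p t = ofFrame (p' t))
    (hq : ∀ t, q t = ofFrame (q' t)) (h0 : p' 0 = q' 0) (i : Fin 3)
    (h1 : lineAt i (p' 1) = lineAt i (q' 1)) :
    (p.map (continuous_vertex (P := ProperDecomposition 3))).Homotopic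
      (q.map continuous_vertex) := by
  have hc : Continuous fun g => ofLine (lineAt i g) :=
    continuous_ofLine.comp (continuous_lineAt i)
  let l : Path (ofLine (lineAt i (p' 0))) (ofLine (lineAt i (p' 1))) :=
    ⟨⟨_, hc.comp p'.continuous⟩, rfl, rfl⟩
  let l' : Path (ofLine (lineAt i (p' 0))) (ofLine (lineAt i (p' 1))) :=
    ⟨⟨_, hc.comp q'.continuous⟩, by rw [h0]; rfl, by rw [h1]; rfl⟩
  refine homotopic_of_le (l := l) (l' := l') (fun t => ?_) (fun t => ?_)
    (homotopic_of_isPair (isPair_ofLine _) l l')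
  · rw [hp]; exact ofFrame_le_ofLine_lineAt _ i
  · rw [hq]; exact ofFrame_le_ofLine_lineAt _ i

/-- Lifts with the same start end in orderings of the same frame that differ by a permutation `τ`. A
fixed index of `τ` allows a direct comparison; a 3-cycle is first corrected by a transposition. -/
theorem homotopic_of_not_isPair {a b : ProperDecomposition 3} (ha : isPair a = false)
    (p q : Path a b) :
    (p.map (continuous_vertex (P := ProperDecomposition 3))).Homotopic
      (q.map continuous_vertex) := by
  obtain ⟨g, rfl⟩ := exists_eq_ofFrame ha
  have lift : ∀ p : Path (ofFrame g) b, ∃ p' : C(unitInterval, OrthogonalFrame),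
      (∀ t, p t = ofFrame (p' t)) ∧ p' 0 = g := fun p =>
    exists_path_lift _ p.toContinuousMap (fun t => card_eq_three (isPair_path p t)) g p.source
  obtain ⟨p', hp, hp0⟩ := lift p
  obtain ⟨q', hq, hq0⟩ := lift q
  have hb : ofFrame (p' 1) = b := by rw [← hp, p.target]
  obtain ⟨τ, hτ⟩ : ∃ τ : Equiv.Perm (Fin 3), (q' 1).1 = (p' 1).1 ∘ τ :=
    ofFrame_eq_ofFrame_iff.1 (by rw [← hp, ← hq, p.target, q.target])
  have hline : ∀ (g g' : OrthogonalFrame) (i : Fin 3), g.1 i = g'.1 i → lineAt i g = lineAt i g' :=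
    fun g g' i h => NonzeroSubspace.ofLine_injective (by rw [ofLine_lineAt, ofLine_lineAt, h])
  -- Only the two 3-cycles lack a fixed index, and each of them agrees with the transposition of 0
  -- and 1 somewhere.
  have hdec : ∀ τ : Equiv.Perm (Fin 3), (∃ i, τ i = i) ∨ ∃ i, τ i = Equiv.swap 0 1 i := by decide
  rcases hdec τ with ⟨i, hi⟩ | ⟨i, hi⟩
  · exact homotopic_of_lineAt_eq p' q' hp hq (hp0.trans hq0.symm) i
      (hline _ _ i (by rw [hτ, Function.comp_apply, hi]))
  -- The loop `W` has the transposition as monodromy. It is null-homotopic in the realization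
  -- because index 2 is fixed, and the lift of `p` followed by `W` ends with the same `i`th line as
  -- the lift of `q`.
  · let w : Path (p' 1) (Equiv.swap (0 : Fin 3) 1 • p' 1) := PathConnectedSpace.somePath _ _
    let W : Path b b := (w.map continuous_ofFrame).cast hb.symm
      ((ofFrame_smul _ _).trans hb).symm
    let P' : Path (p' 0) (p' 1) := ⟨p', rfl, rfl⟩
    have h1 : ((Path.refl b).map (continuous_vertex (P := ProperDecomposition 3))).Homotopic
        (W.map continuous_vertex) := by
      refine homotopic_of_lineAt_eq (ContinuousMap.const _ (p' 1)) w.toContinuousMap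
        (fun t => hb.symm) (fun t => rfl) w.source.symm 2 (hline _ _ 2 ?_)
      change (p' 1).1 2 = (w 1).1 2
      rw [w.target, smul_apply]
      rfl
    have h2 : ((p.trans W).map (continuous_vertex (P := ProperDecomposition 3))).Homotopic
        (q.map continuous_vertex) := by
      refine homotopic_of_lineAt_eq (P'.trans w).toContinuousMap q' (fun t => ?_) hq ?_ i
        (hline _ _ i ?_)
      · change p.trans W t = ofFrame (P'.trans w t)
        rw [Path.trans_apply, Path.trans_apply]
        split_ifs
        · exact hp _
        · rfl
      · change P'.trans w 0 = q' 0
        rw [Path.source, hp0, hq0]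
      · change (P'.trans w 1).1 i = (q' 1).1 i
        rw [Path.target, hτ, smul_apply, Function.comp_apply, hi, Equiv.symm_swap]
    rw [Path.map_trans] at h2
    refine Path.Homotopic.trans ?_ h2
    refine Path.Homotopic.trans ?_ ((Path.Homotopic.refl _).hcomp h1)
    exact ⟨(Path.Homotopy.transRefl (p.map continuous_vertex)).symm⟩

end ProperDecomposition

theorem proposition2p3 : SimplyConnectedSpace (UnitaryPartitionComplex 3) := by
  refine NerveRealization.simplyConnectedSpace ProperDecomposition.eq_of_le_of_isPair_eq
    ProperDecomposition.monotone_isPair ProperDecomposition.continuous_isPair (fun a b p q => ?_)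
    ProperDecomposition.isPathConnected_morphisms (fun a ha => ?_) fun b hb => ?_
  · cases ha : ProperDecomposition.isPair a
    · exact ProperDecomposition.homotopic_of_not_isPair ha p q
    · exact ProperDecomposition.homotopic_of_isPair ha p q
  · obtain ⟨g, rfl⟩ := ProperDecomposition.exists_eq_ofFrame ha
    exact ⟨_, ProperDecomposition.ofFrame_le_ofLine_lineAt g 0,
      ProperDecomposition.isPair_ofLine _⟩
  · obtain ⟨L, rfl⟩ := ProperDecomposition.exists_eq_ofLine hb
    obtain ⟨g, rfl⟩ := OrthogonalFrame.exists_lineAt_eq L 0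
    exact ⟨_, ProperDecomposition.ofFrame_le_ofLine_lineAt g 0,
      ProperDecomposition.isPair_ofFrame g⟩
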